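/- Let $N\ge 2$ players choose actions $a_i\in\mathbb R^n$. Let $H\in\mathbb R^{n\times n}$ be symmetric negative definite, $h\in\mathbb R^n$ with $h\neq 0$, and $\rho_i,\varepsilon_i>0$ for $i=1,\dots,N$. The shared reward is $$R(a_1,\dots,a_N)=\tfrac12\Big\langle \sum_i a_i,\,H\sum_i a_i\Big\rangle+\Big\langle h,\sum_i a_i\Big\rangle ,$$ and player $i$ has payoff $u_i(a)=R(a)-\frac{\rho_i}{2}\|a_i\|^2$. A mixed strategy is a Borel probability measure on $\mathbb R^n$. For a profile $x=(x_1,\dots,x_N)$ of mixed strategies let $x_{-i}=\bigotimes_{j\ne i}x_j$, and for $\tau_i>0$ and a mixed strategy $y$ of player $i$ put $$U_i^{\tau_i,\varepsilon_i}(y,x_{-i})=\inf_{p}\Big\{\mathbb E_{a_i\sim y,\;a_{-i}\sim p}[u_i(a_i,a_{-i})]+\tfrac1{\tau_i}\mathrm{KL}(p,x_{-i})\Big\}-\varepsilon_i\,\mathcal H(y),$$ where $a_i$ and $a_{-i}$ are independent, $p$ runs over all probability measures on $(\mathbb R^n)^{N-1}$ with $\mathrm{KL}(p,x_{-i})<\infty$,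 and $\mathcal H(y)=\int f\log f$ is the negative differential entropy if $y$ has Lebesgue density $f$, and $+\infty$ otherwise. (Expectations take values in $[-\infty,\infty)$; the utility is $-\infty$ whenever the infimum is $-\infty$.) A Gaussian risk-averse quantal response equilibrium (Gaussian RQE) for $\tau=(\tau_1,\dots,\tau_N)$ is a profile $x^\star$ of Gaussian measures such that, for every player $i$, $U_i^{\tau_i,\varepsilon_i}(x_i^\star,x_{-i}^\star)$ is finite and $U_i^{\tau_i,\varepsilon_i}(y,x_{-i}^\star)\le U_i^{\tau_i,\varepsilon_i}(x_i^\star,x_{-i}^\star)$ for all mixed strategies $y$. Let $D\subset(0,\infty)^N$ be the set of those $\tau$ for which there is exactly one Gaussian RQE; denote it by $x^\star(\tau)$ for $\tau\in D$. Then $R$ is integrable under $x^\star(\tau)$ for every $\tau\in D$, and the expected shared reward $$J(\tau)=\mathbb E_{a_i\sim x_i^\star(\tau)\text{ independent}}\,[R(a_1,\dots,a_N)]$$ is strictly increasing on $D$: if $\tau,\tau'\in D$, $\tau_i\le\tau_i'$ for all $i$, and $\tau_i<\tau'_i$ for some $i$, then $J(\tau)<J(\tau')$. In particular, for a common degree of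 risk aversion $\tau_1=\dots=\tau_N=t$ (for instance with $\rho_i=\rho$ and $\varepsilon_i=\varepsilon$ for all $i$), the function $t\mapsto J(t,\dots,t)$ is strictly increasing on the set of $t>0$ with $(t,\dots,t)\in D$. -/

import Mathlib

open MeasureTheory ProbabilityTheory InformationTheory
open scoped ENNReal

noncomputable section

namespace AggregativeGame

/-- The action space `ℝⁿ` of a player, with its Euclidean norm and inner product. -/
abbrev Action (n : ℕ) : Type := EuclideanSpace ℝ (Fin n)

/-- Mixed strategy profiles: a Borel probability measure on `ℝⁿ` for each of the `N` players. -/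
abbrev Profile (N n : ℕ) : Type := Fin N → ProbabilityMeasure (Action n)

/-- Joint actions of the opponents of player `i`. -/
abbrev OpponentAction {N : ℕ} (n : ℕ) (i : Fin N) : Type := {j : Fin N // j ≠ i} → Action n

/-- The expectation of `f` as an extended real number, positive part minus negative part.
It is used only for functions whose positive or whose negative part has a finite integral, up to
the one case that is discussed at `utility`. -/
def extIntegral {α : Type*} [MeasurableSpace α] (μ : Measure α) (f : α → ℝ) : EReal :=
  ((∫⁻ a, ENNReal.ofReal (f a) ∂μ : ℝ≥0∞) : EReal) -
    ((∫⁻ a, ENNReal.ofReal (-f a) ∂μ : ℝ≥0∞) : EReal)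

/-- The shared reward `R(a) = ½⟨s, H s⟩ + ⟨h, s⟩` with `s = a₁ + ⋯ + a_N`. -/
def sharedReward {N n : ℕ} (H : Matrix (Fin n) (Fin n) ℝ) (h : Action n)
    (a : Fin N → Action n) : ℝ :=
  1 / 2 * inner ℝ (∑ i, a i) (Matrix.toEuclideanLin H (∑ i, a i)) + inner ℝ h (∑ i, a i)

/-- The payoff `u_i(a) = R(a) - (ρ_i / 2) ‖a_i‖²` of player `i`. -/
def payoff {N n : ℕ} (H : Matrix (Fin n) (Fin n) ℝ) (h : Action n) (ρ : Fin N → ℝ)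
    (i : Fin N) (a : Fin N → Action n) : ℝ :=
  sharedReward H h a - ρ i / 2 * ‖a i‖ ^ 2

/-- The joint action in which player `i` plays `b` and the opponents play `c`. -/
def joinAction {N n : ℕ} (i : Fin N) (b : Action n) (c : OpponentAction n i) :
    Fin N → Action n :=
  fun j => if hj : j = i then b else c ⟨j, hj⟩

/-- The risk-neutral expected utility `U_i(y, p)` when player `i` plays the mixed strategy `y` and,
independently, the opponents' joint action has law `p`. For negative definite `H` and `ρ_i ≥ 0`
the payoff is bounded above, so this is a well-defined element of `[-∞, ∞)`. -/
def expectedUtility {N n : ℕ} (H : Matrix (Fin n) (Fin n) ℝ) (h : Action n) (ρ : Fin N → ℝ)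
    (i : Fin N) (y : ProbabilityMeasure (Action n))
    (p : ProbabilityMeasure (OpponentAction n i)) : EReal :=
  extIntegral ((y : Measure (Action n)).prod (p : Measure (OpponentAction n i)))
    (fun z => payoff H h ρ i (joinAction i z.1 z.2))

/-- The product law `x_{-i}` of the mixed strategies of the opponents of player `i`. -/
def opponents {N n : ℕ} (x : Profile N n) (i : Fin N) : Measure (OpponentAction n i) :=
  Measure.pi (fun j : {j : Fin N // j ≠ i} => (x j : Measure (Action n)))

/-- The risk-adjusted utility `inf_p U_i(y, p) + (1/τ) KL(p, x_{-i})`, the infimum being over all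
laws `p` of the opponents' joint action. Laws with `KL(p, x_{-i}) = ∞` carry an infinite penalty
and are left out (in `EReal` one has `⊥ + ⊤ = ⊥`). -/
def riskAdjustedUtility {N n : ℕ} (H : Matrix (Fin n) (Fin n) ℝ) (h : Action n)
    (ρ : Fin N → ℝ) (τ : ℝ) (i : Fin N) (y : ProbabilityMeasure (Action n))
    (x : Profile N n) : EReal :=
  ⨅ (p : ProbabilityMeasure (OpponentAction n i))
    (_ : klDiv (p : Measure (OpponentAction n i)) (opponents x i) ≠ ∞),
    expectedUtility H h ρ i y p +
      ((1 / τ : ℝ) : EReal) *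
        ((klDiv (p : Measure (OpponentAction n i)) (opponents x i) : ℝ≥0∞) : EReal)

open scoped Classical in
/-- The negative differential entropy `∫ ρ_y log ρ_y`, where `ρ_y` is the Lebesgue density of `y`;
it is `+∞` if `y` has no density. -/
def negEntropy {n : ℕ} (y : ProbabilityMeasure (Action n)) : EReal :=
  if (y : Measure (Action n)) ≪ volume then
    extIntegral (volume : Measure (Action n)) (fun a =>
      ((y : Measure (Action n)).rnDeriv volume a).toReal *
        Real.log ((y : Measure (Action n)).rnDeriv volume a).toReal)
  else ⊤

/-- The utility `U_i^{τ,ε}(y, x_{-i})` of player `i` who plays `y` against the profile `x`: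
risk-adjusted utility minus `ε` times negative entropy. If `y` has infinite second moment (and
`ρ_i > 0`, `H` is negative definite), the first term is `-∞` and so is the utility, whatever the
entropy is, as `⊥ + ⊤ = ⊥` in `EReal`; if the second moment of `y` is finite, then the negative
entropy is well defined and not `-∞`. -/
def utility {N n : ℕ} (H : Matrix (Fin n) (Fin n) ℝ) (h : Action n) (ρ : Fin N → ℝ)
    (τ ε : ℝ) (i : Fin N) (y : ProbabilityMeasure (Action n)) (x : Profile N n) : EReal :=
  riskAdjustedUtility H h ρ τ i y x - (ε : EReal) * negEntropy y

/-- Risk-averse quantal response equilibrium: no player gains by deviating unilaterally to any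
mixed strategy. -/
def IsRQE {N n : ℕ} (H : Matrix (Fin n) (Fin n) ℝ) (h : Action n) (ρ τ ε : Fin N → ℝ)
    (x : Profile N n) : Prop :=
  ∀ (i : Fin N) (y : ProbabilityMeasure (Action n)),
    utility H h ρ (τ i) (ε i) i y x ≤ utility H h ρ (τ i) (ε i) i (x i) x

/-- Gaussian RQE: an RQE of Gaussian strategies at which all players have finite utility.
Finiteness excludes the trivial profiles at which risk is infinite: against sufficiently spread
out opponents every strategy has utility `-∞`, and so every strategy is a best response. -/
def IsGaussianRQE {N n : ℕ} (H : Matrix (Fin n) (Fin n) ℝ) (h : Action n)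
    (ρ τ ε : Fin N → ℝ) (x : Profile N n) : Prop :=
  (∀ i, IsGaussian (x i : Measure (Action n))) ∧
  (∀ i, utility H h ρ (τ i) (ε i) i (x i) x ≠ ⊥ ∧
    utility H h ρ (τ i) (ε i) i (x i) x ≠ ⊤) ∧
  IsRQE H h ρ τ ε x

/-- The vectors of positive degrees of risk aversion for which there is exactly one
Gaussian RQE. -/
def riskDomain {N n : ℕ} (H : Matrix (Fin n) (Fin n) ℝ) (h : Action n)
    (ρ ε : Fin N → ℝ) : Set (Fin N → ℝ) :=
  {τ | (∀ i, 0 < τ i) ∧ ∃! x : Profile N n, IsGaussianRQE H h ρ τ ε x}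

/-- The law of the joint action when the players draw their actions independently. -/
def jointLaw {N n : ℕ} (x : Profile N n) : Measure (Fin N → Action n) :=
  Measure.pi (fun i => (x i : Measure (Action n)))

/-- The expected shared reward under the profile `x`. -/
def expectedReward {N n : ℕ} (H : Matrix (Fin n) (Fin n) ℝ) (h : Action n)
    (x : Profile N n) : ℝ :=
  ∫ a, sharedReward H h a ∂(jointLaw x)

end AggregativeGame

end

/-! In an eigenbasis `b` of `H`, with `H (b k) = -lam k • b k`, the game splits into coordinates. By
the Donsker–Varadhan principle the infimum over `p` equals `-(1/τ) log E exp(-τ F)`, where `F` is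
the payoff averaged over the player's own strategy (`neg_log_integral_exp_le`,
`le_neg_log_integral_exp`). As the payoff is quadratic, `F` sees that strategy only through its
coordinate means and variances. It is enough to test an equilibrium against affine deviations, whose
effect on means, variances and entropy is explicit (`deviation_le`); the resulting necessary
conditions determine everything that the reward depends on, so no equilibrium has to be constructed.

Own variance enters `F` additively, so its optimality condition is free of `τ`: the covariance is
diagonal with entries `ε i / (lam k + ρ i)` (`coordCov_eq_of_isGaussianRQE`). The opponents'
aggregate then has independent Gaussian coordinates with fixed variances `v = oppVar lam ρ ε i k`.
Finite utility means `τ i * lam k * v < 1`, and risk aversion only replaces the curvature `lam k` in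
the condition for the mean by `lam k / (1 - τ i * lam k * v)` (`coordMean_eq_of_isGaussianRQE`).

Write `η` for the coordinates of `h` and `Q` for `aggResponse`. Summing over players, the mean
aggregate misses the reward's maximizer `η k / lam k` by the factor `1 / (1 + Q k)`. Since `Q`
strictly increases with `τ` while the variances stay fixed, the loss of reward shrinks, strictly
where `η k ≠ 0`. -/

namespace AggregativeGame

/-! ### Extended integrals: Fubini and passage to the limit along truncations. -/

section ExtIntegral

variable {α β : Type*} [MeasurableSpace α] [MeasurableSpace β]

lemma extIntegral_of_integrable {μ : Measure α} {f : α → ℝ} (hf : Integrable f μ) :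
    extIntegral μ f = ((∫ a, f a ∂μ : ℝ) : EReal) := by
  have h1 : ∫⁻ a, ENNReal.ofReal (f a) ∂μ ≠ ∞ := hf.lintegral_lt_top.ne
  have h2 : ∫⁻ a, ENNReal.ofReal (-f a) ∂μ ≠ ∞ := hf.neg.lintegral_lt_top.ne
  rw [integral_eq_lintegral_pos_part_sub_lintegral_neg_part hf, EReal.coe_sub,
    extIntegral, EReal.coe_ennreal_toReal h1, EReal.coe_ennreal_toReal h2]

lemma integrable_of_lintegral_ofReal_ne_top {μ : Measure α} {f : α → ℝ}
    (hf : AEStronglyMeasurable f μ) (h1 : ∫⁻ a, ENNReal.ofReal (f a) ∂μ ≠ ∞)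
    (h2 : ∫⁻ a, ENNReal.ofReal (-f a) ∂μ ≠ ∞) : Integrable f μ := by
  refine ⟨hf, ?_⟩
  have h : ∀ a, ‖f a‖ₑ ≤ ENNReal.ofReal (f a) + ENNReal.ofReal (-f a) := fun a => by
    rw [← ofReal_norm, Real.norm_eq_abs]
    rcases le_total 0 (f a) with h | h
    · rw [abs_of_nonneg h]; exact le_self_add
    · rw [abs_of_nonpos h]; exact le_add_self
  calc ∫⁻ a, ‖f a‖ₑ ∂μ ≤ ∫⁻ a, (ENNReal.ofReal (f a) + ENNReal.ofReal (-f a)) ∂μ :=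
        lintegral_mono h
    _ = ∫⁻ a, ENNReal.ofReal (f a) ∂μ + ∫⁻ a, ENNReal.ofReal (-f a) ∂μ :=
        lintegral_add_left' hf.aemeasurable.ennreal_ofReal _
    _ < ∞ := ENNReal.add_lt_top.2 ⟨h1.lt_top, h2.lt_top⟩

/-- In `EReal` even `⊤ - ⊤` is `⊥`, so a value other than `⊥` makes the negative part finite;
excluding `⊤` then bounds the positive part. -/
lemma integrable_of_extIntegral_ne {μ : Measure α} {f : α → ℝ}
    (hf : AEStronglyMeasurable f μ) (h1 : extIntegral μ f ≠ ⊥) (h2 : extIntegral μ f ≠ ⊤) :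
    Integrable f μ := by
  have hb : ∫⁻ a, ENNReal.ofReal (-f a) ∂μ ≠ ∞ := fun h => h1 (by
    rw [extIntegral, h, EReal.coe_ennreal_top, EReal.sub_top])
  refine integrable_of_lintegral_ofReal_ne_top hf (fun h => h2 ?_) hb
  rw [extIntegral, h, ← EReal.coe_ennreal_toReal hb, EReal.coe_ennreal_top, EReal.top_sub_coe]

lemma extIntegral_mono {μ : Measure α} {f g : α → ℝ} (hfg : ∀ a, f a ≤ g a) :
    extIntegral μ f ≤ extIntegral μ g := by
  refine EReal.sub_le_sub ?_ ?_
  · exact EReal.coe_ennreal_le_coe_ennreal_iff.2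
      (lintegral_mono fun a => ENNReal.ofReal_le_ofReal (hfg a))
  · exact EReal.coe_ennreal_le_coe_ennreal_iff.2
      (lintegral_mono fun a => ENNReal.ofReal_le_ofReal (neg_le_neg (hfg a)))

lemma lintegral_ofReal_ne_top_of_le {μ : Measure α} [IsFiniteMeasure μ] {f : α → ℝ} {C : ℝ}
    (hC : ∀ a, f a ≤ C) : ∫⁻ a, ENNReal.ofReal (f a) ∂μ ≠ ∞ := by
  refine ((lintegral_mono fun a => ENNReal.ofReal_le_ofReal (hC a)).trans_lt ?_).ne
  rw [lintegral_const]
  exact ENNReal.mul_lt_top ENNReal.ofReal_lt_top (measure_lt_top _ _)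

lemma extIntegral_eq_bot {μ : Measure α} [IsFiniteMeasure μ] {f : α → ℝ} {C : ℝ}
    (hf : AEStronglyMeasurable f μ) (hC : ∀ a, f a ≤ C) (hn : ¬ Integrable f μ) :
    extIntegral μ f = ⊥ := by
  have h : ∫⁻ a, ENNReal.ofReal (-f a) ∂μ = ∞ := by
    by_contra h
    exact hn (integrable_of_lintegral_ofReal_ne_top hf (lintegral_ofReal_ne_top_of_le hC) h)
  rw [extIntegral, h, EReal.coe_ennreal_top, EReal.sub_top]

/-- Fubini's theorem for the extended expectation of a function that is bounded above. -/
lemma extIntegral_prod {y : Measure α} {p : Measure β} [IsProbabilityMeasure y]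
    [IsProbabilityMeasure p] {G : α × β → ℝ} {C : ℝ} (hG : Measurable G) (hC : ∀ z, G z ≤ C)
    (hint : ∀ c, Integrable (fun b => G (b, c)) y) :
    extIntegral (y.prod p) G = extIntegral p (fun c => ∫ b, G (b, c) ∂y) := by
  have hF : StronglyMeasurable (fun c => ∫ b, G (b, c) ∂y) :=
    hG.stronglyMeasurable.integral_prod_left'
  by_cases h : Integrable G (y.prod p)
  · rw [extIntegral_of_integrable h, extIntegral_of_integrable h.integral_prod_right,
      integral_prod_symm _ h]
  · rw [extIntegral_eq_bot hG.aestronglyMeasurable hC h,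
      extIntegral_eq_bot (C := C) hF.aestronglyMeasurable]
    · intro c
      calc ∫ b, G (b, c) ∂y ≤ ∫ _, C ∂y :=
            integral_mono (hint c) (integrable_const C) fun b => hC _
        _ = C := by simp
    -- Tonelli for the nonnegative function `C - G`: integrable inner averages would make `G` itself
    -- integrable.
    · intro hFi
      apply h
      have h1 : ∀ c, ∫⁻ b, ENNReal.ofReal (C - G (b, c)) ∂y
          = ENNReal.ofReal (C - ∫ b, G (b, c) ∂y) := fun c => by
        rw [← ofReal_integral_eq_lintegral_ofReal
          (f := fun b => C - G (b, c)) ((integrable_const C).sub (hint c))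
          (Filter.Eventually.of_forall fun b => sub_nonneg.2 (hC _)),
          integral_sub (integrable_const C) (hint c)]
        simp
      have h2 : ∫⁻ z, ENNReal.ofReal (C - G z) ∂(y.prod p) ≠ ∞ := by
        rw [lintegral_prod_symm _ (by fun_prop)]
        simp_rw [h1]
        exact ((integrable_const C).sub hFi).lintegral_lt_top.ne
      have h3 : Integrable (fun z => C - G z) (y.prod p) := by
        refine integrable_of_lintegral_ofReal_ne_top (by fun_prop) h2 ?_
        refine lintegral_ofReal_ne_top_of_le (C := 0) fun z => ?_
        linarith [hC z]
      refine ((integrable_const C).sub h3).congr (Filter.Eventually.of_forall fun z => ?_)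
      simp

/-- Fatou's lemma along the truncations `min f (n + 1)`, made nonnegative by subtracting a lower
bound. -/
lemma integrable_of_integral_min_le {μ : Measure α} [IsProbabilityMeasure μ] {f : α → ℝ}
    {c B : ℝ} (hf : Measurable f) (hc : ∀ a, c ≤ f a)
    (hB : ∀ n : ℕ, ∫ a, min (f a) (n + 1 : ℝ) ∂μ ≤ B) :
    Integrable f μ ∧ ∫ a, f a ∂μ ≤ B := by
  -- Taking the minimum with `0` keeps `c'` below the truncation levels as well.
  set c' := min c 0
  have hc' : ∀ a, c' ≤ f a := fun a => (min_le_left _ _).trans (hc a)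
  have hmin : ∀ (n : ℕ) a, c' ≤ min (f a) (n + 1 : ℝ) := fun n a =>
    le_min (hc' a) ((min_le_right _ _).trans (by positivity))
  have hi : ∀ n : ℕ, Integrable (fun a => min (f a) (n + 1 : ℝ)) μ := fun n =>
    Integrable.of_mem_Icc c' (n + 1 : ℝ) (by fun_prop)
      (Filter.Eventually.of_forall fun a => ⟨hmin n a, min_le_right _ _⟩)
  have key : ∫⁻ a, ENNReal.ofReal (f a - c') ∂μ ≤ ENNReal.ofReal (B - c') := by
    have hlim : ∀ a, ENNReal.ofReal (f a - c') = Filter.liminf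
        (fun n : ℕ => ENNReal.ofReal (min (f a) (n + 1 : ℝ) - c')) Filter.atTop := fun a => by
      refine (Filter.Tendsto.liminf_eq (tendsto_const_nhds.congr' ?_)).symm
      obtain ⟨m, hm⟩ := exists_nat_ge (f a)
      filter_upwards [Filter.eventually_ge_atTop m] with n hn
      have : (m : ℝ) ≤ n := by exact_mod_cast hn
      rw [min_eq_left (by linarith)]
    simp_rw [hlim]
    refine (lintegral_liminf_le (fun n => by fun_prop)).trans ?_
    refine Filter.liminf_le_of_le (by isBoundedDefault) fun b hb => ?_
    obtain ⟨n, hn⟩ := hb.exists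
    refine hn.trans ?_
    rw [← ofReal_integral_eq_lintegral_ofReal
      (f := fun a => min (f a) (n + 1 : ℝ) - c') ((hi n).sub (integrable_const c'))
      (Filter.Eventually.of_forall fun a => sub_nonneg.2 (hmin n a)),
      integral_sub (hi n) (integrable_const c')]
    refine ENNReal.ofReal_le_ofReal ?_
    simpa using hB n
  have h3 : Integrable (fun a => f a - c') μ := by
    refine integrable_of_lintegral_ofReal_ne_top (by fun_prop)
      (key.trans_lt ENNReal.ofReal_lt_top).ne ?_
    refine lintegral_ofReal_ne_top_of_le (C := 0) fun z => ?_
    linarith [hc' z]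
  have hfi : Integrable f μ :=
    (h3.add (integrable_const c')).congr (Filter.Eventually.of_forall fun z => by simp)
  refine ⟨hfi, ?_⟩
  rw [← ofReal_integral_eq_lintegral_ofReal h3
    (Filter.Eventually.of_forall fun a => sub_nonneg.2 (hc' a)),
    integral_sub hfi (integrable_const c')] at key
  have hB' : 0 ≤ B - c' := by
    have h0 := integral_mono (integrable_const c') (hi 0) (hmin 0)
    have := h0.trans (hB 0)
    simp at this
    linarith
  have := (ENNReal.ofReal_le_ofReal_iff hB').1 key
  simp at this
  linarith

end ExtIntegral

/-! ### The Donsker–Varadhan variational principle. -/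

section Gibbs

variable {Ω : Type*} [MeasurableSpace Ω]

/-- The lower bound in the Gibbs (Donsker–Varadhan) variational principle. -/
lemma neg_log_integral_exp_le {π p : Measure Ω} [IsProbabilityMeasure π] [IsProbabilityMeasure p]
    {F : Ω → ℝ} {C τ : ℝ} (hτ : 0 < τ) (hF : Measurable F) (hC : ∀ c, F c ≤ C)
    (hi : Integrable (fun c => Real.exp (-τ * F c)) π) (hp : klDiv p π ≠ ∞) :
    ((-(1 / τ) * Real.log (∫ c, Real.exp (-τ * F c) ∂π) : ℝ) : EReal) ≤
      extIntegral p F + ((1 / τ : ℝ) : EReal) * ((klDiv p π : ℝ≥0∞) : EReal) := by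
  obtain ⟨hac, hllr⟩ := klDiv_ne_top_iff.1 hp
  set Z := ∫ c, Real.exp (-τ * F c) ∂π
  have hkl := toReal_klDiv_of_measure_eq hac (by simp)
  have hlow : ∀ c, -(τ * C) ≤ -τ * F c := fun c => by nlinarith [hC c]
  -- The exponent is truncated to a bounded `g`. The inequality is then `KL(p, π.tilted g) ≥ 0`,
  -- with `log ∫ exp g ≤ log Z`.
  have hB : ∀ n : ℕ, ∫ c, min (-τ * F c) (n + 1 : ℝ) ∂p ≤ (klDiv p π).toReal + Real.log Z := by
    intro n
    set g : Ω → ℝ := fun c => min (-τ * F c) (n + 1 : ℝ)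
    have hgm : Measurable g := by fun_prop
    have hgp : Integrable g p := Integrable.of_mem_Icc (min (-(τ * C)) (n + 1)) (n + 1 : ℝ)
      hgm.aemeasurable
      (Filter.Eventually.of_forall fun a => ⟨min_le_min_right _ (hlow a), min_le_right _ _⟩)
    have hgle : ∀ c, Real.exp (g c) ≤ Real.exp (-τ * F c) := fun c =>
      Real.exp_le_exp.2 (min_le_left _ _)
    have hge : Integrable (fun c => Real.exp (g c)) π :=
      hi.mono' (by fun_prop) (Filter.Eventually.of_forall fun c => by
        rw [Real.norm_of_nonneg (Real.exp_pos _).le]; exact hgle c)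
    have h1 := integral_llr_tilted_right hac hgp hge hllr
    have := isProbabilityMeasure_tilted hge
    have h2 := integral_llr_add_sub_measure_univ_nonneg
      (hac.trans (absolutelyContinuous_tilted hge))
      (integrable_llr_tilted_right hac hgp hllr hge)
    have h3 : Real.log (∫ c, Real.exp (g c) ∂π) ≤ Real.log Z :=
      Real.log_le_log (integral_exp_pos hge) (integral_mono hge hi hgle)
    simp at h2
    linarith
  obtain ⟨h1, h2⟩ := integrable_of_integral_min_le (by fun_prop) hlow hB
  have hFi : Integrable F p := by
    simpa [hτ.ne'] using h1.const_mul (-τ)⁻¹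
  rw [extIntegral_of_integrable hFi, ← EReal.coe_ennreal_toReal hp, ← EReal.coe_mul,
    ← EReal.coe_add, EReal.coe_le_coe_iff]
  rw [integral_const_mul] at h2
  have : (∫ c, F c ∂p) + 1 / τ * (klDiv p π).toReal - (-(1 / τ) * Real.log Z)
      = 1 / τ * ((klDiv p π).toReal + Real.log Z - -τ * ∫ c, F c ∂p) := by
    field_simp; ring
  have h4 : 0 ≤ 1 / τ * ((klDiv p π).toReal + Real.log Z - -τ * ∫ c, F c ∂p) :=
    mul_nonneg (by positivity) (by linarith)
  linarith

/-- The upper bound in the Gibbs (Donsker–Varadhan) variational principle, together with the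
exponential integrability that a finite infimum entails. -/
lemma le_neg_log_integral_exp {π : Measure Ω} [IsProbabilityMeasure π]
    {F : Ω → ℝ} {C τ B : ℝ} (hτ : 0 < τ) (hF : Measurable F) (hC : ∀ c, F c ≤ C)
    (hB : ∀ p : ProbabilityMeasure Ω, klDiv (p : Measure Ω) π ≠ ∞ → (B : EReal) ≤
      extIntegral (p : Measure Ω) F +
        ((1 / τ : ℝ) : EReal) * ((klDiv (p : Measure Ω) π : ℝ≥0∞) : EReal)) :
    Integrable (fun c => Real.exp (-τ * F c)) π ∧
      B ≤ -(1 / τ) * Real.log (∫ c, Real.exp (-τ * F c) ∂π) := by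
  have hlow : ∀ c, -(τ * C) ≤ -τ * F c := fun c => by nlinarith [hC c]
  have key : ∀ n : ℕ, ∫ c, min (Real.exp (-τ * F c)) (n + 1 : ℝ) ∂π ≤ Real.exp (-τ * B) := by
    intro n
    -- The test law is the Gibbs law of the truncated exponent; truncating at `log (n + 1)` makes
    -- `exp g` the truncation of the weight at `n + 1`.
    set g : Ω → ℝ := fun c => min (-τ * F c) (Real.log (n + 1 : ℝ))
    have hgm : Measurable g := by fun_prop
    have hge' : ∀ c, min (Real.exp (-τ * F c)) (n + 1 : ℝ) = Real.exp (g c) := fun c => by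
      rw [Real.exp_monotone.map_min, Real.exp_log (by positivity)]
    simp_rw [hge']
    have hbd : ∀ a, g a ∈ Set.Icc (min (-(τ * C)) (Real.log (n + 1))) (Real.log (n + 1 : ℝ)) :=
      fun a => ⟨min_le_min_right _ (hlow a), min_le_right _ _⟩
    have hge : Integrable (fun c => Real.exp (g c)) π :=
      Integrable.of_mem_Icc 0 (n + 1 : ℝ) (by fun_prop) (Filter.Eventually.of_forall fun a =>
        ⟨(Real.exp_pos _).le, by rw [← hge']; exact min_le_right _ _⟩)
    have hprob := isProbabilityMeasure_tilted hge
    have hgp : Integrable g (π.tilted g) := Integrable.of_mem_Icc _ _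
      hgm.aemeasurable (Filter.Eventually.of_forall hbd)
    have hac : π.tilted g ≪ π := tilted_absolutelyContinuous π g
    have hl : llr (π.tilted g) π =ᵐ[π.tilted g]
        fun c => g c - Real.log (∫ c, Real.exp (g c) ∂π) :=
      hac.ae_le (log_rnDeriv_tilted_left_self hge)
    have hli : Integrable (llr (π.tilted g) π) (π.tilted g) :=
      (integrable_congr hl).2 (hgp.sub (integrable_const _))
    have hne := klDiv_ne_top hac hli
    have hkl := toReal_klDiv_of_measure_eq hac (by simp)
    rw [integral_congr_ae hl, integral_sub hgp (integrable_const _)] at hkl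
    have h1 := hB ⟨π.tilted g, hprob⟩ hne
    simp only [ProbabilityMeasure.coe_mk] at h1
    -- With `F` replaced by the larger `-(1 / τ) * g`, the integral of `g` cancels against the one
    -- in the divergence, leaving `-(1 / τ)` times the log-partition function.
    have h2 : extIntegral (π.tilted g) F ≤ ((-(1 / τ) * ∫ c, g c ∂(π.tilted g) : ℝ) : EReal) := by
      rw [← integral_const_mul, ← extIntegral_of_integrable (hgp.const_mul _)]
      refine extIntegral_mono fun a => ?_
      have : g a ≤ -τ * F a := min_le_left _ _
      have h5 : -(1 / τ) * g a - F a = 1 / τ * (-τ * F a - g a) := by field_simp; ring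
      have h6 : 0 ≤ 1 / τ * (-τ * F a - g a) := mul_nonneg (by positivity) (by linarith)
      linarith
    have h3 := h1.trans (add_le_add_left h2 _)
    rw [← EReal.coe_ennreal_toReal hne, hkl, ← EReal.coe_mul,
      ← EReal.coe_add, EReal.coe_le_coe_iff] at h3
    simp only [integral_const, probReal_univ, smul_eq_mul, one_mul] at h3
    have h4 : Real.log (∫ c, Real.exp (g c) ∂π) ≤ -τ * B := by
      have : -(1 / τ) * ∫ c, g c ∂(π.tilted g) + 1 / τ * ((∫ c, g c ∂(π.tilted g))
          - Real.log (∫ c, Real.exp (g c) ∂π)) = -(1 / τ * Real.log (∫ c, Real.exp (g c) ∂π)) := by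
        ring
      have h7 : B ≤ -(1 / τ * Real.log (∫ c, Real.exp (g c) ∂π)) := by linarith
      have h8 := mul_le_mul_of_nonneg_left h7 hτ.le
      have h9 : τ * -(1 / τ * Real.log (∫ c, Real.exp (g c) ∂π))
        = -Real.log (∫ c, Real.exp (g c) ∂π) := by field_simp
      linarith
    exact (Real.log_le_iff_le_exp (integral_exp_pos hge)).1 h4
  obtain ⟨h1, h2⟩ := integrable_of_integral_min_le (by fun_prop)
    (fun c => (Real.exp_pos _).le) key
  refine ⟨h1, ?_⟩
  have h3 := (Real.log_le_iff_le_exp (integral_exp_pos h1)).2 h2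
  have h4 : -(1 / τ) * Real.log (∫ c, Real.exp (-τ * F c) ∂π) - B
      = 1 / τ * (-τ * B - Real.log (∫ c, Real.exp (-τ * F c) ∂π)) := by field_simp; ring
  have h5 : 0 ≤ 1 / τ * (-τ * B - Real.log (∫ c, Real.exp (-τ * F c) ∂π)) :=
    mul_nonneg (by positivity) (by linarith)
  linarith

end Gibbs

/-! ### Entropy under affine changes of variables. -/

section Entropy

variable {n : ℕ}

lemma volume_map_affine {A : Action n →ₗ[ℝ] Action n} (hA : LinearMap.det A ≠ 0) (w : Action n) :
    (volume : Measure (Action n)).map (fun a => A a + w) =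
      ENNReal.ofReal |(LinearMap.det A)⁻¹| • volume := by
  have hAm : Measurable A := A.continuous_of_finiteDimensional.measurable
  have h : (fun a => A a + w) = (fun a => a + w) ∘ A := rfl
  rw [h, ← Measure.map_map (by fun_prop) hAm,
    Measure.map_linearMap_addHaar_eq_smul_addHaar _ hA, Measure.map_smul,
    map_add_right_eq_self]

lemma measurableEmbedding_affine {A : Action n →ₗ[ℝ] Action n} (hA : LinearMap.det A ≠ 0)
    (w : Action n) : MeasurableEmbedding (fun a => A a + w) := by
  have h : (fun a => A a + w) = (fun a => a + w) ∘
      (A.equivOfDetNeZero hA).toContinuousLinearEquiv.toHomeomorph := rfl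
  rw [h]
  exact (measurableEmbedding_addRight w).comp (Homeomorph.measurableEmbedding _)

/-- An invertible affine map decreases the negative differential entropy by the logarithm of its
Jacobian. -/
lemma negEntropy_map_affine {A : Action n →ₗ[ℝ] Action n} (hA : LinearMap.det A ≠ 0)
    (w : Action n) {y y' : ProbabilityMeasure (Action n)}
    (hy' : (y' : Measure (Action n)) = (y : Measure (Action n)).map (fun a => A a + w))
    {e : ℝ} (he : negEntropy y = e) :
    negEntropy y' = ((e - Real.log |LinearMap.det A| : ℝ) : EReal) := by
  set d := |(LinearMap.det A)⁻¹| with hd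
  have hd0 : 0 < d := abs_pos.2 (inv_ne_zero hA)
  have hemb := measurableEmbedding_affine hA w
  have hvol := volume_map_affine hA w
  have hac : (y : Measure (Action n)) ≪ volume := by
    by_contra h
    rw [negEntropy, if_neg h] at he
    exact EReal.top_ne_coe _ he
  have hdE : ENNReal.ofReal d ≠ 0 := by simpa using hd0
  have hac' : (y' : Measure (Action n)) ≪ volume := by
    rw [hy']
    exact (hac.map hemb.measurable).trans (hvol ▸ Measure.smul_absolutelyContinuous)
  rw [negEntropy, if_pos hac] at he
  rw [negEntropy, if_pos hac']
  set f : Action n → ℝ := fun a => ((y : Measure (Action n)).rnDeriv volume a).toReal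
  set f' : Action n → ℝ := fun a => ((y' : Measure (Action n)).rnDeriv volume a).toReal
  have hfi : Integrable f := Measure.integrable_toReal_rnDeriv
  have hf1 : ∫ a, f a = 1 := by
    have := Measure.integral_toReal_rnDeriv hac
    simpa using this
  have hφ : Measurable (fun a => f a * Real.log (f a)) := by
    have : Measurable f := (Measure.measurable_rnDeriv _ _).ennreal_toReal
    fun_prop
  have hφ' : Measurable (fun a => f' a * Real.log (f' a)) := by
    have : Measurable f' := (Measure.measurable_rnDeriv _ _).ennreal_toReal
    fun_prop
  have hent : Integrable (fun a => f a * Real.log (f a)) :=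
    integrable_of_extIntegral_ne hφ.aestronglyMeasurable (by rw [he]; simp) (by rw [he]; simp)
  rw [extIntegral_of_integrable hent, EReal.coe_eq_coe_iff] at he
  have hrel : ∀ᵐ a, f' (A a + w) = d * f a := by
    have h1 := hemb.rnDeriv_map (y : Measure (Action n)) (volume : Measure (Action n))
    rw [← hy', hvol] at h1
    have h2 := Measure.rnDeriv_smul_right_of_ne_top (y' : Measure (Action n)) volume hdE
      ENNReal.ofReal_ne_top
    -- An almost-everywhere identity may be evaluated at `A a + w` because the affine map sends
    -- `volume` to a multiple of itself.
    have h3 : ∀ᵐ a, (y' : Measure (Action n)).rnDeriv (ENNReal.ofReal d • volume) (A a + w)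
        = ((ENNReal.ofReal d)⁻¹ • (y' : Measure (Action n)).rnDeriv volume) (A a + w) := by
      refine ae_of_ae_map (f := fun a => A a + w) (p := fun b =>
        (y' : Measure (Action n)).rnDeriv (ENNReal.ofReal d • volume) b
          = ((ENNReal.ofReal d)⁻¹ • (y' : Measure (Action n)).rnDeriv volume) b)
        hemb.measurable.aemeasurable ?_
      rw [hvol]
      exact Measure.smul_absolutelyContinuous.ae_le h2
    filter_upwards [h1, h3] with a ha hb
    have hc : (y : Measure (Action n)).rnDeriv volume a
        = (ENNReal.ofReal d)⁻¹ * (y' : Measure (Action n)).rnDeriv volume (A a + w) := by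
      rw [← ha, hb]; rfl
    simp only [f, f']
    rw [hc, ENNReal.toReal_mul, ENNReal.toReal_inv, ENNReal.toReal_ofReal hd0.le]
    field_simp
  have hcomp : ∀ᵐ a, f' (A a + w) * Real.log (f' (A a + w))
      = d * (f a * Real.log (f a)) + d * Real.log d * f a := by
    filter_upwards [hrel] with a ha
    rw [ha]
    by_cases h0 : f a = 0
    · simp [h0]
    · rw [Real.log_mul hd0.ne' h0]; ring
  have hRi : Integrable (fun a => d * (f a * Real.log (f a)) + d * Real.log d * f a) :=
    (hent.const_mul d).add (hfi.const_mul _)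
  have hi1 : Integrable (fun a => f' a * Real.log (f' a)) (ENNReal.ofReal d • volume) := by
    rw [← hvol, hemb.integrable_map_iff]
    exact (integrable_congr hcomp).2 hRi
  have hi2 : Integrable (fun a => f' a * Real.log (f' a)) :=
    (integrable_smul_measure hdE ENNReal.ofReal_ne_top).1 hi1
  have hint : d * ∫ a, f' a * Real.log (f' a) = d * e + d * Real.log d := by
    have h1 : ∫ a, f' a * Real.log (f' a) ∂(ENNReal.ofReal d • volume)
        = d * ∫ a, f' a * Real.log (f' a) := by
      rw [integral_smul_measure, ENNReal.toReal_ofReal hd0.le, smul_eq_mul]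
    rw [← h1, ← hvol, hemb.integral_map, integral_congr_ae hcomp,
      integral_add (hent.const_mul d) (hfi.const_mul _), integral_const_mul, integral_const_mul,
      he, hf1, mul_one]
  rw [extIntegral_of_integrable hi2, EReal.coe_eq_coe_iff]
  have hlog : Real.log d = -Real.log |LinearMap.det A| := by
    rw [hd, abs_inv, Real.log_inv]
  rw [← mul_add] at hint
  rw [mul_left_cancel₀ hd0.ne' hint, hlog]
  ring

end Entropy

/-! ### Exponentials of squares under Gaussian measures. -/

section GaussianIntegrals

open scoped NNReal

/-- Completing the square: the weight turns a Gaussian density into a multiple of another one, whose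
precision is `1 / v - a`. -/
lemma gaussianPDFReal_mul_exp_sq {μ a c : ℝ} {v : ℝ≥0} (hv : v ≠ 0) (hav : a * v < 1) (z : ℝ) :
    gaussianPDFReal μ v z * Real.exp (a / 2 * (z + c) ^ 2) =
      (1 / √(1 - a * v) * Real.exp (a / (2 * (1 - a * v)) * (μ + c) ^ 2)) *
        gaussianPDFReal ((μ + a * v * c) / (1 - a * v)) (v / (1 - a * v).toNNReal) z := by
  have hv' : (0 : ℝ) < v := by positivity
  have h1 : 0 < 1 - a * v := by linarith
  simp only [gaussianPDFReal, NNReal.coe_div, Real.coe_toNNReal _ h1.le]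
  have hs : (√(2 * Real.pi * (v / (1 - a * v))))⁻¹ = (√(2 * Real.pi * v))⁻¹ * √(1 - a * v) := by
    rw [← mul_div_assoc, Real.sqrt_div (by positivity), inv_div, div_eq_mul_inv, mul_comm]
  have hsq : √(1 - a * v) ≠ 0 := (Real.sqrt_pos.2 h1).ne'
  rw [hs, mul_assoc, ← Real.exp_add]
  have he : 1 / √(1 - a * v) * Real.exp (a / (2 * (1 - a * v)) * (μ + c) ^ 2) *
      ((√(2 * Real.pi * v))⁻¹ * √(1 - a * v) *
        Real.exp (-(z - (μ + a * v * c) / (1 - a * v)) ^ 2 / (2 * (v / (1 - a * v))))) =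
      (√(2 * Real.pi * v))⁻¹ * (Real.exp (a / (2 * (1 - a * v)) * (μ + c) ^ 2) *
        Real.exp (-(z - (μ + a * v * c) / (1 - a * v)) ^ 2 / (2 * (v / (1 - a * v))))) := by
    field_simp
  rw [he, ← Real.exp_add]
  congr 2
  obtain ⟨D, hD⟩ : ∃ D, D = 1 - a * v := ⟨_, rfl⟩
  rw [← hD] at h1 ⊢
  have h1' := h1.ne'
  have ha : a = (1 - D) / v := by field_simp; linarith
  rw [ha]
  field_simp
  ring

lemma integrable_exp_sq_gaussianReal {μ a c : ℝ} {v : ℝ≥0} (hv : v ≠ 0) (hav : a * v < 1) :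
    Integrable (fun z => Real.exp (a / 2 * (z + c) ^ 2)) (gaussianReal μ v) := by
  rw [gaussianReal_of_var_ne_zero _ hv, gaussianPDF_def,
    integrable_withDensity_iff_integrable_smul' (by fun_prop) (by simp)]
  simp only [ENNReal.toReal_ofReal (gaussianPDFReal_nonneg _ _ _), smul_eq_mul,
    gaussianPDFReal_mul_exp_sq hv hav]
  exact (integrable_gaussianPDFReal _ _).const_mul _

lemma integral_exp_sq_gaussianReal {μ a c : ℝ} {v : ℝ≥0} (hv : v ≠ 0) (hav : a * v < 1) :
    ∫ z, Real.exp (a / 2 * (z + c) ^ 2) ∂(gaussianReal μ v) =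
      1 / √(1 - a * v) * Real.exp (a / (2 * (1 - a * v)) * (μ + c) ^ 2) := by
  rw [integral_gaussianReal_eq_integral_smul hv]
  simp only [smul_eq_mul, gaussianPDFReal_mul_exp_sq hv hav]
  rw [integral_const_mul, integral_gaussianPDFReal_eq_one, mul_one]
  have h1 : 0 < 1 - a * v := by linarith
  exact div_ne_zero hv (by simpa using h1)

/-- At every point the integrand or its reflection `z ↦ -z` is at least `exp C`, according to the
sign of `B * z`, and a positive constant is not integrable on the line. -/
lemma not_integrable_exp_quadratic {A B C : ℝ} (hA : 0 ≤ A) :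
    ¬ Integrable (fun z : ℝ => Real.exp (A * z ^ 2 + B * z + C)) := by
  intro h
  have h2 : Integrable (fun _ : ℝ => Real.exp C) := by
    refine (h.add h.comp_neg).mono' (by fun_prop) (Filter.Eventually.of_forall fun z => ?_)
    rw [Real.norm_of_nonneg (Real.exp_pos _).le]
    simp only [Pi.add_apply]
    rcases le_total 0 (B * z) with hz | hz
    · have : Real.exp C ≤ Real.exp (A * z ^ 2 + B * z + C) :=
        Real.exp_le_exp.2 (by nlinarith [mul_nonneg hA (sq_nonneg z)])
      linarith [Real.exp_pos (A * (-z) ^ 2 + B * (-z) + C)]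
    · have : Real.exp C ≤ Real.exp (A * (-z) ^ 2 + B * (-z) + C) :=
        Real.exp_le_exp.2 (by nlinarith [mul_nonneg hA (sq_nonneg z)])
      linarith [Real.exp_pos (A * z ^ 2 + B * z + C)]
  rw [integrable_const_iff] at h2
  rcases h2 with h2 | h2
  · exact (Real.exp_pos C).ne' h2
  · exact absurd (h2.measure_univ_lt_top) (by simp)

/-- If `a * v ≥ 1`, the weight times the density is the exponential of a quadratic with leading
coefficient `a / 2 - 1 / (2 * v) ≥ 0`. -/
lemma lt_one_of_integrable_exp_sq_gaussianReal {μ a c : ℝ} {v : ℝ≥0} (hv : v ≠ 0)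
    (h : Integrable (fun z => Real.exp (a / 2 * (z + c) ^ 2)) (gaussianReal μ v)) :
    a * v < 1 := by
  by_contra! hav
  have hv' : (0 : ℝ) < v := by positivity
  rw [gaussianReal_of_var_ne_zero _ hv, gaussianPDF_def,
    integrable_withDensity_iff_integrable_smul' (by fun_prop) (by simp)] at h
  simp only [ENNReal.toReal_ofReal (gaussianPDFReal_nonneg _ _ _), smul_eq_mul] at h
  simp only [gaussianPDFReal] at h
  have h2 := h.const_mul (√(2 * Real.pi * v))
  refine not_integrable_exp_quadratic (A := a / 2 - 1 / (2 * v)) (B := a * c + μ / v)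
    (C := a / 2 * c ^ 2 - μ ^ 2 / (2 * v)) ?_ (h2.congr (Filter.Eventually.of_forall fun z => ?_))
  · rw [div_sub_div _ _ (by norm_num) (by positivity)]
    exact div_nonneg (by linarith) (by positivity)
  · simp only
    have hs : √(2 * Real.pi * v) ≠ 0 := (Real.sqrt_pos.2 (by positivity)).ne'
    rw [← mul_assoc, ← mul_assoc, mul_inv_cancel₀ hs, one_mul, ← Real.exp_add]
    congr 1
    field_simp
    ring

variable {ι : Type*} [Fintype ι]

/-- The `lintegral` of the product factorizes; all factors are nonzero by positivity, so one
infinite factor would make the product infinite. -/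
lemma Integrable.of_fintype_prod {E : ι → Type*} [∀ i, MeasurableSpace (E i)]
    {μ : ∀ i, Measure (E i)} [∀ i, IsProbabilityMeasure (μ i)] {f : ∀ i, E i → ℝ}
    (hf : ∀ i, Measurable (f i)) (hpos : ∀ i z, 0 < f i z)
    (h : Integrable (fun x : ∀ i, E i => ∏ i, f i (x i)) (Measure.pi μ)) (k : ι) :
    Integrable (f k) (μ k) := by
  have hind : iIndepFun (fun i (x : ∀ i, E i) => ENNReal.ofReal (f i (x i))) (Measure.pi μ) :=
    iIndepFun_pi (X := fun i z => ENNReal.ofReal (f i z)) fun i => by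
      have := hf i; fun_prop
  have h1 := lintegral_prod_eq_prod_lintegral_of_indepFun Finset.univ _ hind
    (fun i => by have := hf i; fun_prop)
  have h2 : ∫⁻ x, ∏ i, ENNReal.ofReal (f i (x i)) ∂(Measure.pi μ) ≠ ∞ := by
    simp_rw [← ENNReal.ofReal_prod_of_nonneg (fun i _ => (hpos i _).le)]
    exact h.lintegral_lt_top.ne
  have hmp : ∀ i, ∫⁻ x, ENNReal.ofReal (f i (x i)) ∂(Measure.pi μ)
      = ∫⁻ z, ENNReal.ofReal (f i z) ∂(μ i) := fun i =>
    (measurePreserving_eval μ i).lintegral_comp (f := fun z => ENNReal.ofReal (f i z))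
      (by have := hf i; fun_prop)
  rw [h1] at h2
  simp_rw [hmp] at h2
  have hne : ∀ i, ∫⁻ z, ENNReal.ofReal (f i z) ∂(μ i) ≠ 0 := fun i h0 => by
    rw [lintegral_eq_zero_iff (by have := hf i; fun_prop)] at h0
    obtain ⟨z, hz⟩ := h0.exists
    simp only [Pi.zero_apply, ENNReal.ofReal_eq_zero] at hz
    exact absurd (hpos i z) (not_lt.2 hz)
  have h3 : ∫⁻ z, ENNReal.ofReal (f k z) ∂(μ k) ≠ ∞ := fun htop => by
    classical
    rw [← Finset.mul_prod_erase _ _ (Finset.mem_univ k), htop] at h2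
    exact h2 (ENNReal.top_mul (Finset.prod_ne_zero_iff.2 fun i _ => hne i))
  refine integrable_of_lintegral_ofReal_ne_top (hf k).aestronglyMeasurable h3 ?_
  exact lintegral_ofReal_ne_top_of_le (C := 0) fun z => by linarith [hpos k z]

end GaussianIntegrals

/-! ### The payoff in eigencoordinates and its average over the own strategy. -/

section Payoff

variable {N n : ℕ}

/-- The negative definite matrix `H` has an orthonormal eigenbasis with negative eigenvalues. -/
lemma exists_eigenbasis {H : Matrix (Fin n) (Fin n) ℝ} (hH : (-H).PosDef) :
    ∃ (b : OrthonormalBasis (Fin n) ℝ (Action n)) (lam : Fin n → ℝ), (∀ k, 0 < lam k) ∧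
      ∀ k, Matrix.toEuclideanLin H (b k) = -lam k • b k := by
  refine ⟨hH.1.eigenvectorBasis, hH.1.eigenvalues, hH.eigenvalues_pos, fun k => ?_⟩
  have h := hH.1.mulVec_eigenvectorBasis k
  ext j
  have hj := congrFun h j
  simp only [Matrix.neg_mulVec, Pi.neg_apply, Pi.smul_apply] at hj
  simp only [neg_smul, PiLp.neg_apply, PiLp.smul_apply, ← hj, neg_neg]
  rfl

/-- The expected payoff, in eigencoordinates of `H`, against the opponents' aggregate `z`, of a
mixed strategy with coordinate means `m` and coordinate variances `σ`. -/
noncomputable def meanPayoff (lam η : Fin n → ℝ) (r : ℝ) (m σ z : Fin n → ℝ) : ℝ :=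
  ∑ k, (-lam k / 2 * ((m k + z k) ^ 2 + σ k) + η k * (m k + z k) - r / 2 * (m k ^ 2 + σ k))

/-- The coordinates of an action in an orthonormal basis. -/
noncomputable def coords (b : OrthonormalBasis (Fin n) ℝ (Action n)) (a : Action n) : Fin n → ℝ :=
  fun k => inner ℝ (b k) a

variable {b : OrthonormalBasis (Fin n) ℝ (Action n)} {lam : Fin n → ℝ}
  {H : Matrix (Fin n) (Fin n) ℝ}

lemma inner_toEuclideanLin_self (hb : ∀ k, Matrix.toEuclideanLin H (b k) = -lam k • b k)
    (s : Action n) :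
    inner ℝ s (Matrix.toEuclideanLin H s) = ∑ k, -lam k * (inner ℝ (b k) s) ^ 2 := by
  have hs : Matrix.toEuclideanLin H s = ∑ k, inner ℝ (b k) s • -lam k • b k := by
    conv_lhs => rw [← b.sum_repr' s]
    simp only [map_sum, map_smul, hb]
  rw [hs, inner_sum]
  refine Finset.sum_congr rfl fun k _ => ?_
  rw [inner_smul_right, inner_smul_right, real_inner_comm]
  ring

lemma inner_eq_sum_coords (h s : Action n) :
    inner ℝ h s = ∑ k, inner ℝ (b k) h * inner ℝ (b k) s := by
  rw [← b.sum_inner_mul_inner h s]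
  exact Finset.sum_congr rfl fun k _ => by rw [real_inner_comm]

lemma sharedReward_eq (hb : ∀ k, Matrix.toEuclideanLin H (b k) = -lam k • b k)
    (h : Action n) (a : Fin N → Action n) :
    sharedReward H h a = ∑ k, (-lam k / 2 * (inner ℝ (b k) (∑ i, a i)) ^ 2
      + inner ℝ (b k) h * inner ℝ (b k) (∑ i, a i)) := by
  rw [sharedReward, inner_toEuclideanLin_self hb, inner_eq_sum_coords (b := b) h,
    Finset.mul_sum, ← Finset.sum_add_distrib]
  exact Finset.sum_congr rfl fun k _ => by ring

lemma sum_joinAction (i : Fin N) (a : Action n) (c : OpponentAction n i) :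
    ∑ j, joinAction i a c j = a + ∑ j, c j := by
  rw [Fintype.sum_eq_add_sum_subtype_ne _ i]
  congr 1
  · simp [joinAction]
  · refine Finset.sum_congr rfl fun j _ => ?_
    simp [joinAction, j.2]

lemma payoff_joinAction_eq (hb : ∀ k, Matrix.toEuclideanLin H (b k) = -lam k • b k)
    (h : Action n) (ρ : Fin N → ℝ) (i : Fin N) (a : Action n) (c : OpponentAction n i) :
    payoff H h ρ i (joinAction i a c) =
      meanPayoff lam (coords b h) (ρ i) (coords b a) 0 (coords b (∑ j, c j)) := by
  have hn : ‖a‖ ^ 2 = ∑ k, inner ℝ (b k) a ^ 2 := by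
    rw [← real_inner_self_eq_norm_sq, inner_eq_sum_coords (b := b)]
    exact Finset.sum_congr rfl fun k _ => by ring
  have hi : joinAction i a c i = a := by simp [joinAction]
  rw [payoff, sharedReward_eq hb, sum_joinAction, hi, hn, Finset.mul_sum,
    ← Finset.sum_sub_distrib, meanPayoff]
  refine Finset.sum_congr rfl fun k _ => ?_
  simp only [coords, inner_add_right, Pi.zero_apply]
  ring

lemma meanPayoff_le {η m σ z : Fin n → ℝ} {r : ℝ} (hlam : ∀ k, 0 < lam k) (hr : 0 ≤ r)
    (hσ : ∀ k, 0 ≤ σ k) : meanPayoff lam η r m σ z ≤ ∑ k, η k ^ 2 / (2 * lam k) := by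
  refine Finset.sum_le_sum fun k _ => ?_
  have h1 : η k ^ 2 / (2 * lam k) - (-lam k / 2 * (m k + z k) ^ 2 + η k * (m k + z k))
      = lam k / 2 * (m k + z k - η k / lam k) ^ 2 := by
    have := (hlam k).ne'
    field_simp
    ring
  have h2 : 0 ≤ lam k / 2 * (m k + z k - η k / lam k) ^ 2 := by
    have := hlam k
    positivity
  have h3 : 0 ≤ lam k / 2 * σ k := mul_nonneg (by linarith [hlam k]) (hσ k)
  have h4 : 0 ≤ r / 2 * (m k ^ 2 + σ k) :=
    mul_nonneg (by linarith) (by linarith [sq_nonneg (m k), hσ k])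
  linarith

/-- The coordinate means of a measure. -/
noncomputable def coordMean (b : OrthonormalBasis (Fin n) ℝ (Action n)) (y : Measure (Action n)) :
    Fin n → ℝ :=
  fun k => ∫ a, inner ℝ (b k) a ∂y

/-- The coordinate covariances of a measure. -/
noncomputable def coordCov (b : OrthonormalBasis (Fin n) ℝ (Action n)) (y : Measure (Action n))
    (k l : Fin n) : ℝ :=
  cov[fun a => inner ℝ (b k) a, fun a => inner ℝ (b l) a; y]

lemma integrable_quadratic {Ω : Type*} [MeasurableSpace Ω] {μ : Measure Ω}
    [IsProbabilityMeasure μ] {X : Ω → ℝ} (hX : MemLp X 2 μ) (A B C : ℝ) :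
    Integrable (fun ω => A * X ω ^ 2 + B * X ω + C) μ :=
  ((hX.integrable_sq.const_mul A).add ((hX.integrable (by norm_num)).const_mul B)).add
    (integrable_const C)

lemma integral_quadratic {Ω : Type*} [MeasurableSpace Ω] {μ : Measure Ω}
    [IsProbabilityMeasure μ] {X : Ω → ℝ} (hX : MemLp X 2 μ) (A B C : ℝ) :
    ∫ ω, (A * X ω ^ 2 + B * X ω + C) ∂μ =
      A * (Var[X; μ] + (∫ ω, X ω ∂μ) ^ 2) + B * ∫ ω, X ω ∂μ + C := by
  have h1 := hX.integrable_sq.const_mul A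
  have h2 := (hX.integrable (q := 2) (by norm_num)).const_mul B
  rw [integral_add (f := fun ω => A * X ω ^ 2 + B * X ω) (h1.add h2) (integrable_const C),
    integral_add h1 h2, integral_const_mul, integral_const_mul, variance_eq_sub hX]
  simp

lemma memLp_inner {y : Measure (Action n)} (hy : MemLp id 2 y) (v : Action n) :
    MemLp (fun a => inner ℝ v a) 2 y := by
  simpa using hy.const_inner v

lemma coordCov_self (y : Measure (Action n)) (k : Fin n) :
    coordCov b y k k = Var[fun a => inner ℝ (b k) a; y] :=
  covariance_self (by fun_prop)

lemma meanPayoff_zero_eq (η : Fin n → ℝ) (r : ℝ) (z : Fin n → ℝ) (a : Action n) :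
    meanPayoff lam η r (coords b a) 0 z = ∑ k, ((-lam k / 2 - r / 2) * (inner ℝ (b k) a) ^ 2
      + (-lam k * z k + η k) * inner ℝ (b k) a + (-lam k / 2 * z k ^ 2 + η k * z k)) := by
  refine Finset.sum_congr rfl fun k _ => ?_
  simp only [coords, Pi.zero_apply]
  ring

lemma integrable_meanPayoff {y : Measure (Action n)} [IsProbabilityMeasure y]
    (hy : MemLp id 2 y) (η : Fin n → ℝ) (r : ℝ) (z : Fin n → ℝ) :
    Integrable (fun a => meanPayoff lam η r (coords b a) 0 z) y := by
  simp_rw [meanPayoff_zero_eq]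
  exact integrable_finsetSum _ fun k _ => integrable_quadratic (memLp_inner hy _) _ _ _

lemma integral_meanPayoff {y : Measure (Action n)} [IsProbabilityMeasure y]
    (hy : MemLp id 2 y) (η : Fin n → ℝ) (r : ℝ) (z : Fin n → ℝ) :
    ∫ a, meanPayoff lam η r (coords b a) 0 z ∂y =
      meanPayoff lam η r (coordMean b y) (fun k => coordCov b y k k) z := by
  simp_rw [meanPayoff_zero_eq]
  rw [integral_finsetSum _ fun k _ => integrable_quadratic (memLp_inner hy _) _ _ _]
  refine Finset.sum_congr rfl fun k _ => ?_
  rw [integral_quadratic (memLp_inner hy _), coordMean]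
  simp only [coordCov_self]
  ring

lemma coordCov_self_nonneg (y : Measure (Action n)) (k : Fin n) : 0 ≤ coordCov b y k k := by
  rw [coordCov_self]
  exact variance_nonneg _ _

lemma measurable_meanPayoff_coords (lam : Fin n → ℝ) (h : Action n) (r : ℝ) (i : Fin N) :
    Measurable fun z : Action n × OpponentAction n i => meanPayoff lam (coords b h) r
      (coords b z.1) 0 (coords b (∑ j, z.2 j)) := by
  unfold meanPayoff coords
  have h1 : ∀ k, Measurable fun z : Action n × OpponentAction n i =>
    (inner ℝ (b k) z.1 : ℝ) := fun k => by fun_prop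
  have h2 : ∀ k, Measurable fun z : Action n × OpponentAction n i =>
    (inner ℝ (b k) (∑ j, z.2 j) : ℝ) := fun k => by fun_prop
  simp only [Pi.zero_apply]
  refine Finset.measurable_sum _ fun k _ => ?_
  have h1k := h1 k
  have h2k := h2 k
  fun_prop

/-- The payoff is a sum of quadratics in single coordinates, so averaging over `y` leaves only means
and variances. Fubini applies since `meanPayoff_le` bounds the payoff above. -/
lemma expectedUtility_eq (hlam : ∀ k, 0 < lam k)
    (hb : ∀ k, Matrix.toEuclideanLin H (b k) = -lam k • b k)
    (h : Action n) {ρ : Fin N → ℝ} (i : Fin N) (hρ : 0 ≤ ρ i)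
    {y : ProbabilityMeasure (Action n)} (hy : MemLp id 2 (y : Measure (Action n)))
    (p : ProbabilityMeasure (OpponentAction n i)) :
    expectedUtility H h ρ i y p = extIntegral (p : Measure (OpponentAction n i)) (fun c =>
      meanPayoff lam (coords b h) (ρ i) (coordMean b y) (fun k => coordCov b y k k)
        (coords b (∑ j, c j))) := by
  have hle : ∀ z : Action n × OpponentAction n i, meanPayoff lam (coords b h) (ρ i)
      (coords b z.1) 0 (coords b (∑ j, z.2 j)) ≤ ∑ k, coords b h k ^ 2 / (2 * lam k) :=
    fun z => meanPayoff_le hlam hρ fun k => le_refl ((0 : Fin n → ℝ) k)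
  have hint : ∀ c : OpponentAction n i, Integrable (fun a => meanPayoff lam (coords b h) (ρ i)
      (coords b a) 0 (coords b (∑ j, c j))) (y : Measure (Action n)) := fun c =>
    integrable_meanPayoff hy (coords b h) (ρ i) (coords b (∑ j, c j))
  have h1 := extIntegral_prod (p := (p : Measure (OpponentAction n i)))
    (measurable_meanPayoff_coords lam h (ρ i) i) hle hint
  rw [expectedUtility]
  simp only [payoff_joinAction_eq hb]
  refine h1.trans (congrArg _ (funext fun c => ?_))
  exact integral_meanPayoff hy (coords b h) (ρ i) (coords b (∑ j, c j))

end Payoff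

/-! ### Risk-adjusted utility of affine deviations from an equilibrium. -/

section Deviation

variable {N n : ℕ} {b : OrthonormalBasis (Fin n) ℝ (Action n)} {lam : Fin n → ℝ}
  {H : Matrix (Fin n) (Fin n) ℝ}

instance (x : Profile N n) (i : Fin N) : IsProbabilityMeasure (opponents x i) := by
  unfold opponents
  infer_instance

/-- The unnormalized density, with respect to the opponents' law, of the worst-case law that a
player with coordinate means `m` and variances `σ` faces. -/
noncomputable def gibbsWeight (b : OrthonormalBasis (Fin n) ℝ (Action n)) (lam : Fin n → ℝ)
    (h : Action n) (r τ : ℝ) (m σ : Fin n → ℝ) {ι : Type*} [Fintype ι] (c : ι → Action n) : ℝ :=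
  Real.exp (-τ * meanPayoff lam (coords b h) r m σ (coords b (∑ j, c j)))

lemma measurable_meanPayoff_sum (lam η : Fin n → ℝ) (r : ℝ) (m σ : Fin n → ℝ)
    {ι : Type*} [Fintype ι] :
    Measurable fun c : ι → Action n => meanPayoff lam η r m σ (coords b (∑ j, c j)) := by
  unfold meanPayoff coords
  have h2 : ∀ k, Measurable fun c : ι → Action n =>
    (inner ℝ (b k) (∑ j, c j) : ℝ) := fun k => by fun_prop
  refine Finset.measurable_sum _ fun k _ => ?_
  have h2k := h2 k
  fun_prop

lemma le_riskAdjustedUtility (hlam : ∀ k, 0 < lam k)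
    (hb : ∀ k, Matrix.toEuclideanLin H (b k) = -lam k • b k)
    (h : Action n) {ρ : Fin N → ℝ} {τ : ℝ} (hτ : 0 < τ) (i : Fin N) (hρ : 0 ≤ ρ i)
    {y : ProbabilityMeasure (Action n)} (hy : MemLp id 2 (y : Measure (Action n)))
    {x : Profile N n}
    (hi : Integrable (gibbsWeight b lam h (ρ i) τ (coordMean b y) (fun k => coordCov b y k k))
      (opponents x i)) :
    ((-(1 / τ) * Real.log (∫ c, gibbsWeight b lam h (ρ i) τ (coordMean b y)
      (fun k => coordCov b y k k) c ∂(opponents x i)) : ℝ) : EReal) ≤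
      riskAdjustedUtility H h ρ τ i y x := by
  refine le_iInf₂ fun p hp => ?_
  rw [expectedUtility_eq hlam hb h i hρ hy]
  exact neg_log_integral_exp_le hτ (measurable_meanPayoff_sum _ _ _ _ _)
    (fun c => meanPayoff_le hlam hρ fun k => coordCov_self_nonneg _ _) hi hp

lemma riskAdjustedUtility_le (hlam : ∀ k, 0 < lam k)
    (hb : ∀ k, Matrix.toEuclideanLin H (b k) = -lam k • b k)
    (h : Action n) {ρ : Fin N → ℝ} {τ : ℝ} (hτ : 0 < τ) (i : Fin N) (hρ : 0 ≤ ρ i)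
    {y : ProbabilityMeasure (Action n)} (hy : MemLp id 2 (y : Measure (Action n)))
    {x : Profile N n} {B : ℝ} (hB : (B : EReal) ≤ riskAdjustedUtility H h ρ τ i y x) :
    Integrable (gibbsWeight b lam h (ρ i) τ (coordMean b y) (fun k => coordCov b y k k))
      (opponents x i) ∧
    B ≤ -(1 / τ) * Real.log (∫ c, gibbsWeight b lam h (ρ i) τ (coordMean b y)
      (fun k => coordCov b y k k) c ∂(opponents x i)) := by
  refine le_neg_log_integral_exp hτ (measurable_meanPayoff_sum _ _ _ _ _)
    (fun c => meanPayoff_le hlam hρ fun k => coordCov_self_nonneg _ _) fun p hp => ?_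
  rw [← expectedUtility_eq hlam hb h i hρ hy]
  exact hB.trans (iInf₂_le p hp)

/-- Infinite terms never cancel to a real number in `EReal`. Thus finite equilibrium utility yields
finite risk-adjusted utility and finite entropy. -/
lemma exists_real_of_sub_mul_ne {u v : EReal} {ε : ℝ} (hε : 0 < ε)
    (h1 : u - (ε : EReal) * v ≠ ⊥) (h2 : u - (ε : EReal) * v ≠ ⊤) :
    ∃ r e : ℝ, u = r ∧ v = e := by
  induction v with
  | bot =>
    rw [EReal.coe_mul_bot_of_pos hε] at h1 h2
    induction u with
    | bot => simp at h1
    | coe u => simp [sub_eq_add_neg] at h2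
    | top => simp [sub_eq_add_neg] at h2
  | top => rw [EReal.coe_mul_top_of_pos hε, EReal.sub_top] at h1; exact absurd rfl h1
  | coe e =>
    rw [← EReal.coe_mul] at h1 h2
    induction u with
    | bot => simp [sub_eq_add_neg] at h1
    | coe u => exact ⟨u, e, rfl, rfl⟩
    | top => rw [EReal.top_sub_coe] at h2; exact absurd rfl h2

/-- The linear part of an elementary deviation. -/
noncomputable def shear (b : OrthonormalBasis (Fin n) ℝ (Action n)) (k l : Fin n) (t : ℝ) :
    Action n →ₗ[ℝ] Action n :=
  LinearMap.transvection (innerSL ℝ (b l)).toLinearMap (t • b k)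

lemma shear_apply (k l : Fin n) (t : ℝ) (a : Action n) :
    shear b k l t a = a + (t * inner ℝ (b l) a) • b k := by
  simp [shear, LinearMap.transvection, smul_smul, mul_comm]

lemma inner_basis (k l : Fin n) : (inner ℝ (b k) (b l) : ℝ) = if k = l then 1 else 0 :=
  orthonormal_iff_ite.1 b.orthonormal k l

lemma det_shear (k l : Fin n) (t : ℝ) :
    LinearMap.det (shear b k l t) = 1 + if l = k then t else 0 := by
  rw [shear, LinearMap.transvection.det]
  simp [inner_basis]

lemma inner_shear_add (q k l : Fin n) (t s : ℝ) (a : Action n) :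
    inner ℝ (b q) (shear b k l t a + s • b k) =
      inner ℝ (b q) a + if q = k then t * inner ℝ (b l) a + s else 0 := by
  rw [shear_apply, inner_add_right, inner_add_right, inner_smul_right, inner_smul_right,
    inner_basis]
  split_ifs <;> ring

lemma measurable_shear_add (k l : Fin n) (t s : ℝ) :
    Measurable fun a => shear b k l t a + s • b k := by
  simp_rw [shear_apply]
  fun_prop

lemma memLp_id_map_shear {y : Measure (Action n)} [IsProbabilityMeasure y] (hy : MemLp id 2 y)
    (k l : Fin n) (t s : ℝ) :
    MemLp id 2 (y.map fun a => shear b k l t a + s • b k) := by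
  rw [memLp_map_measure_iff (by fun_prop) (measurable_shear_add k l t s).aemeasurable]
  have h : (id ∘ fun a => shear b k l t a + s • b k) =
      fun a => id a + t • (innerSL ℝ (b l)).smulRight (b k) (id a) + s • b k := by
    funext a
    simp [shear_apply, smul_smul]
  rw [h]
  exact (hy.add ((((innerSL ℝ (b l)).smulRight (b k)).comp_memLp' hy).const_smul t)).add
    (memLp_const _)

lemma coordMean_map_shear {y : Measure (Action n)} [IsProbabilityMeasure y] (hy : MemLp id 2 y)
    (k l : Fin n) (t s : ℝ) :
    coordMean b (y.map fun a => shear b k l t a + s • b k) =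
      fun q => coordMean b y q + if q = k then t * coordMean b y l + s else 0 := by
  funext q
  have h1 := fun q => (memLp_inner hy (b q)).integrable (q := 2) (by norm_num)
  simp only [coordMean]
  rw [integral_map (measurable_shear_add k l t s).aemeasurable (by fun_prop)]
  simp only [inner_shear_add]
  by_cases hq : q = k
  · simp only [hq, if_true]
    rw [integral_add (g := fun a => t * inner ℝ (b l) a + s) (h1 k)
        (((h1 l).const_mul t).add (integrable_const s)),
      integral_add ((h1 l).const_mul t) (integrable_const s), integral_const_mul]
    simp
  · simp [hq]

lemma coordCov_map_shear {y : Measure (Action n)} [IsProbabilityMeasure y] (hy : MemLp id 2 y)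
    (k l : Fin n) (t s : ℝ) :
    (fun q => coordCov b (y.map fun a => shear b k l t a + s • b k) q q) =
      fun q => coordCov b y q q +
        if q = k then 2 * t * coordCov b y k l + t ^ 2 * coordCov b y l l else 0 := by
  funext q
  have h1 := fun q => memLp_inner hy (b q)
  rw [coordCov_self, coordCov_self,
    variance_map (by fun_prop) (measurable_shear_add k l t s).aemeasurable]
  simp only [Function.comp_def, inner_shear_add]
  by_cases hq : q = k
  · subst hq
    simp only [if_true, ← add_assoc]
    rw [variance_add_const (X := fun a => inner ℝ (b q) a + t * inner ℝ (b l) a) (((h1 q).add ((h1 l).const_mul t)).aestronglyMeasurable),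
      variance_fun_add (h1 q) ((h1 l).const_mul t), variance_const_mul,
      covariance_const_mul_right, coordCov_self, coordCov]
    ring
  · simp [hq]

/-- The optimality condition that an equilibrium strategy satisfies with respect to the deviation
`a ↦ a + (t ⟨b l, a⟩ + s) b k`. -/
lemma deviation_le (hlam : ∀ k, 0 < lam k)
    (hb : ∀ k, Matrix.toEuclideanLin H (b k) = -lam k • b k)
    {h : Action n} {ρ τ ε : Fin N → ℝ} {x : Profile N n} (hx : IsGaussianRQE H h ρ τ ε x)
    (i : Fin N) (hρ : 0 ≤ ρ i) (hτ : 0 < τ i) (hε : 0 < ε i) :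
    Integrable (gibbsWeight b lam h (ρ i) (τ i) (coordMean b (x i))
      (fun k => coordCov b (x i) k k)) (opponents x i) ∧
    ∀ (k l : Fin n) (t s : ℝ), (0 < 1 + if l = k then t else 0) → ∀ m' σ' : Fin n → ℝ,
      (m' = fun q => coordMean b (x i) q + if q = k then t * coordMean b (x i) l + s else 0) →
      (σ' = fun q => coordCov b (x i) q q + if q = k then
        2 * t * coordCov b (x i) k l + t ^ 2 * coordCov b (x i) l l else 0) →
      Integrable (gibbsWeight b lam h (ρ i) (τ i) m' σ') (opponents x i) →
      -(1 / τ i) * Real.log (∫ c, gibbsWeight b lam h (ρ i) (τ i) m' σ' c ∂(opponents x i))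
        + ε i * Real.log (1 + if l = k then t else 0) ≤
      -(1 / τ i) * Real.log (∫ c, gibbsWeight b lam h (ρ i) (τ i) (coordMean b (x i))
        (fun k => coordCov b (x i) k k) c ∂(opponents x i)) := by
  obtain ⟨hG, hfin, hopt⟩ := hx
  have := hG i
  have hy : MemLp id 2 (x i : Measure (Action n)) := IsGaussian.memLp_two_id
  obtain ⟨r, e, hr, he⟩ := exists_real_of_sub_mul_ne hε (hfin i).1 (hfin i).2
  obtain ⟨hint, hle⟩ := riskAdjustedUtility_le hlam hb h hτ i hρ hy hr.ge
  refine ⟨hint, fun k l t s hpos m' σ' hm' hσ' hi' => ?_⟩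
  have hT := measurable_shear_add (b := b) k l t s
  have hp : IsProbabilityMeasure
      ((x i : Measure (Action n)).map fun a => shear b k l t a + s • b k) :=
    Measure.isProbabilityMeasure_map hT.aemeasurable
  set y' : ProbabilityMeasure (Action n) := ⟨_, hp⟩
  have hdet : LinearMap.det (shear b k l t) ≠ 0 := by rw [det_shear]; exact hpos.ne'
  have hent : negEntropy y' = _ := negEntropy_map_affine hdet (s • b k) (y := x i) rfl he
  have hy' : MemLp id 2 (y' : Measure (Action n)) := memLp_id_map_shear hy k l t s
  have hmy : coordMean b y' = m' := (coordMean_map_shear hy k l t s).trans hm'.symm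
  have hσy : (fun q => coordCov b y' q q) = σ' := (coordCov_map_shear hy k l t s).trans hσ'.symm
  -- One half of the variational principle at each strategy suffices: the lower bound at the
  -- deviation, the upper bound (`hle`) at the equilibrium.
  have hlow := le_riskAdjustedUtility hlam hb h hτ i hρ hy' (x := x) (by rwa [hmy, hσy])
  rw [hmy, hσy] at hlow
  have hdev := hopt i y'
  rw [utility, utility, hr, he, hent] at hdev
  have h3 := (EReal.sub_le_sub hlow le_rfl).trans hdev
  rw [← EReal.coe_mul, ← EReal.coe_mul, ← EReal.coe_sub, ← EReal.coe_sub,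
    EReal.coe_le_coe_iff, det_shear, abs_of_pos hpos] at h3
  linarith

end Deviation

/-! ### Law of an aggregate of independent Gaussian actions, for the opponents or for all players.
-/

section AggregateLaw

variable {n : ℕ} {b : OrthonormalBasis (Fin n) ℝ (Action n)} {lam : Fin n → ℝ}
  {ι : Type*} [Fintype ι] {μ : ι → Measure (Action n)} [∀ j, IsGaussian (μ j)]

lemma iIndepFun_eval : iIndepFun (fun j (c : ι → Action n) => c j) (Measure.pi μ) :=
  iIndepFun_pi (X := fun _ a => a) fun _ => aemeasurable_id

lemma map_eval_pi (j : ι) : (Measure.pi μ).map (fun c : ι → Action n => c j) = μ j :=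
  (measurePreserving_eval μ j).map_eq

lemma hasGaussianLaw_coords_sum :
    HasGaussianLaw (fun (c : ι → Action n) k => coords b (∑ j, c j) k) (Measure.pi μ) := by
  have h : HasGaussianLaw (fun (c : ι → Action n) j => c j) (Measure.pi μ) :=
    iIndepFun_eval.hasGaussianLaw fun j => ⟨by rw [map_eval_pi]; infer_instance⟩
  exact h.fun_sum.map_fun (ContinuousLinearMap.pi fun k => innerSL ℝ (b k))

lemma memLp_coords_eval (j : ι) (k : Fin n) :
    MemLp (fun c : ι → Action n => (inner ℝ (b k) (c j) : ℝ)) 2 (Measure.pi μ) :=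
  (memLp_inner (IsGaussian.memLp_two_id (μ := μ j)) (b k)).comp_measurePreserving
    (measurePreserving_eval μ j)

lemma memLp_coords_sum (k : Fin n) :
    MemLp (fun c : ι → Action n => (inner ℝ (b k) (∑ j, c j) : ℝ)) 2 (Measure.pi μ) := by
  simp_rw [inner_sum]
  exact memLp_finsetSum _ fun j _ => memLp_coords_eval j k

lemma integral_coords_sum (k : Fin n) :
    ∫ c : ι → Action n, (inner ℝ (b k) (∑ j, c j) : ℝ) ∂(Measure.pi μ)
      = ∑ j, coordMean b (μ j) k := by
  simp_rw [inner_sum]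
  rw [integral_finsetSum _ fun j _ => (memLp_coords_eval j k).integrable (by norm_num)]
  refine Finset.sum_congr rfl fun j _ => ?_
  rw [coordMean, ← map_eval_pi (μ := μ) j,
    integral_map (measurable_pi_apply j).aemeasurable (by fun_prop)]

lemma covariance_coords_sum (k l : Fin n) :
    cov[fun c : ι → Action n => (inner ℝ (b k) (∑ j, c j) : ℝ),
      fun c => (inner ℝ (b l) (∑ j, c j) : ℝ); Measure.pi μ] = ∑ j, coordCov b (μ j) k l := by
  classical
  simp_rw [inner_sum]
  rw [covariance_fun_sum_fun_sum (fun j => memLp_coords_eval j k)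
    (fun j => memLp_coords_eval j l)]
  refine Finset.sum_congr rfl fun j _ => ?_
  rw [Finset.sum_eq_single j]
  · have hm : AEMeasurable (fun c : ι → Action n => c j) (Measure.pi μ) :=
      (measurable_pi_apply j).aemeasurable
    rw [coordCov, ← map_eval_pi (μ := μ) j,
      covariance_map_fun (Continuous.aestronglyMeasurable (by fun_prop))
      (Continuous.aestronglyMeasurable (by fun_prop)) hm]
  · intro j' _ hj
    have hind := (iIndepFun_eval (μ := μ)).indepFun hj.symm
    exact (hind.comp (φ := fun a => (inner ℝ (b k) a : ℝ)) (ψ := fun a => (inner ℝ (b l) a : ℝ))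
      (by fun_prop) (by fun_prop)).covariance_eq_zero (memLp_coords_eval j k)
        (memLp_coords_eval j' l)
  · simp

/-- The coordinates of the aggregate are jointly Gaussian and, by `hoff`, uncorrelated, hence
independent. -/
lemma map_coords_sum (hoff : ∀ j k l, k ≠ l → coordCov b (μ j) k l = 0) :
    (Measure.pi μ).map (fun c => coords b (∑ j, c j)) =
      Measure.pi fun k => gaussianReal (∑ j, coordMean b (μ j) k)
        (∑ j, coordCov b (μ j) k k).toNNReal := by
  have hG := hasGaussianLaw_coords_sum (b := b) (μ := μ)
  have hind : iIndepFun (fun k (c : ι → Action n) => coords b (∑ j, c j) k) (Measure.pi μ) :=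
    hG.iIndepFun_of_covariance_eq_zero fun k l hkl =>
      (covariance_coords_sum k l).trans (Finset.sum_eq_zero fun j _ => hoff j k l hkl)
  have h1 := hind.map_fun_eq_pi_map fun k => (hG.eval k).aemeasurable
  refine h1.trans (congrArg _ (funext fun k => ?_))
  rw [(hG.eval k).map_eq_gaussianReal, ← covariance_self (hG.eval k).aemeasurable]
  congr 1
  · exact integral_coords_sum k
  · congr 1
    exact covariance_coords_sum k k

end AggregateLaw

/-! ### Closed form of the Gibbs integral. -/

section GibbsIntegral

variable {n : ℕ} {b : OrthonormalBasis (Fin n) ℝ (Action n)} {lam : Fin n → ℝ}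
  {ι : Type*} [Fintype ι] {μ : ι → Measure (Action n)} [∀ j, IsGaussian (μ j)]

/-- The exponent of the part of the Gibbs weight that does not depend on the opponents. -/
noncomputable def gibbsConst (lam η : Fin n → ℝ) (r τ : ℝ) (m σ : Fin n → ℝ) (k : Fin n) : ℝ :=
  -τ * η k ^ 2 / (2 * lam k) + τ * lam k / 2 * σ k + τ * r / 2 * (m k ^ 2 + σ k)

lemma exp_meanPayoff_eq (hlam : ∀ k, 0 < lam k) (η : Fin n → ℝ) (r τ : ℝ)
    (m σ z : Fin n → ℝ) :
    Real.exp (-τ * meanPayoff lam η r m σ z) =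
      Real.exp (∑ k, gibbsConst lam η r τ m σ k) *
        ∏ k, Real.exp (τ * lam k / 2 * (z k + (m k - η k / lam k)) ^ 2) := by
  rw [← Real.exp_sum, ← Real.exp_add, meanPayoff, Finset.mul_sum, ← Finset.sum_add_distrib]
  congr 1
  refine Finset.sum_congr rfl fun k _ => ?_
  have := (hlam k).ne'
  rw [gibbsConst]
  field_simp
  ring

lemma measurable_coords_sum : Measurable fun c : ι → Action n => coords b (∑ j, c j) := by
  refine measurable_pi_iff.2 fun k => ?_
  unfold coords
  fun_prop

/-- The weight is a product of one-dimensional Gaussian weights. The criterion does not involve `m`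
or `σ`, so integrability at the equilibrium passes to every deviation. -/
lemma integrable_gibbsWeight_iff (hlam : ∀ k, 0 < lam k)
    (hoff : ∀ j k l, k ≠ l → coordCov b (μ j) k l = 0)
    (hV : ∀ k, 0 < ∑ j, coordCov b (μ j) k k) (h : Action n) (r τ : ℝ) (m σ : Fin n → ℝ) :
    Integrable (gibbsWeight b lam h r τ m σ) (Measure.pi μ) ↔
      ∀ k, τ * lam k * ∑ j, coordCov b (μ j) k k < 1 := by
  have hfun : gibbsWeight b lam h r τ m σ = (fun z : Fin n → ℝ =>
      Real.exp (∑ k, gibbsConst lam (coords b h) r τ m σ k) *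
        ∏ k, Real.exp (τ * lam k / 2 * (z k + (m k - coords b h k / lam k)) ^ 2)) ∘
      (fun c : ι → Action n => coords b (∑ j, c j)) :=
    funext fun c => exp_meanPayoff_eq hlam _ _ _ _ _ _
  rw [hfun, ← integrable_map_measure (Continuous.aestronglyMeasurable (by fun_prop))
      measurable_coords_sum.aemeasurable,
    map_coords_sum hoff, integrable_const_mul_iff (Real.exp_pos _).ne'.isUnit
      (fun z : Fin n → ℝ =>
        ∏ k, Real.exp (τ * lam k / 2 * (z k + (m k - coords b h k / lam k)) ^ 2))]
  have hv : ∀ k, (∑ j, coordCov b (μ j) k k).toNNReal ≠ 0 := fun k => by simpa using hV k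
  have hv' : ∀ k, ((∑ j, coordCov b (μ j) k k).toNNReal : ℝ) = ∑ j, coordCov b (μ j) k k :=
    fun k => Real.coe_toNNReal _ (hV k).le
  constructor
  · intro hi k
    rw [← hv']
    exact lt_one_of_integrable_exp_sq_gaussianReal (hv k)
      (Integrable.of_fintype_prod (f := fun k z =>
        Real.exp (τ * lam k / 2 * (z + (m k - coords b h k / lam k)) ^ 2))
        (fun k => by fun_prop) (fun k z => Real.exp_pos _) hi k)
  · intro hlt
    refine Integrable.fintype_prod (f := fun k z =>
      Real.exp (τ * lam k / 2 * (z + (m k - coords b h k / lam k)) ^ 2)) fun k => ?_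
    exact integrable_exp_sq_gaussianReal (hv k) (by rw [hv']; exact hlt k)

lemma log_integral_gibbsWeight (hlam : ∀ k, 0 < lam k)
    (hoff : ∀ j k l, k ≠ l → coordCov b (μ j) k l = 0)
    (hV : ∀ k, 0 < ∑ j, coordCov b (μ j) k k) (h : Action n) (r τ : ℝ) (m σ : Fin n → ℝ)
    (hlt : ∀ k, τ * lam k * ∑ j, coordCov b (μ j) k k < 1) :
    Real.log (∫ c, gibbsWeight b lam h r τ m σ c ∂(Measure.pi μ)) =
      ∑ k, (gibbsConst lam (coords b h) r τ m σ k
        + Real.log (1 / √(1 - τ * lam k * ∑ j, coordCov b (μ j) k k))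
        + τ * lam k / (2 * (1 - τ * lam k * ∑ j, coordCov b (μ j) k k)) *
          (∑ j, coordMean b (μ j) k + (m k - coords b h k / lam k)) ^ 2) := by
  have hv : ∀ k, (∑ j, coordCov b (μ j) k k).toNNReal ≠ 0 := fun k => by simpa using hV k
  have hv' : ∀ k, ((∑ j, coordCov b (μ j) k k).toNNReal : ℝ) = ∑ j, coordCov b (μ j) k k :=
    fun k => Real.coe_toNNReal _ (hV k).le
  have h1 : ∫ c, gibbsWeight b lam h r τ m σ c ∂(Measure.pi μ) =
      ∫ z : Fin n → ℝ, Real.exp (∑ k, gibbsConst lam (coords b h) r τ m σ k) *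
        ∏ k, Real.exp (τ * lam k / 2 * (z k + (m k - coords b h k / lam k)) ^ 2)
        ∂((Measure.pi μ).map (fun c => coords b (∑ j, c j))) := by
    rw [integral_map measurable_coords_sum.aemeasurable
      (Continuous.aestronglyMeasurable (by fun_prop))]
    exact integral_congr_ae (Filter.Eventually.of_forall fun c =>
      exp_meanPayoff_eq hlam _ _ _ _ _ _)
  rw [h1, map_coords_sum hoff, integral_const_mul,
    integral_fintype_prod_eq_prod (fun k z =>
      Real.exp (τ * lam k / 2 * (z + (m k - coords b h k / lam k)) ^ 2)),
    Finset.prod_congr rfl fun k _ => integral_exp_sq_gaussianReal (hv k)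
      (by rw [hv']; exact hlt k)]
  simp_rw [hv']
  have hs : ∀ k, 0 < 1 / √(1 - τ * lam k * ∑ j, coordCov b (μ j) k k) := fun k =>
    one_div_pos.2 (Real.sqrt_pos.2 (by linarith [hlt k]))
  have hne : ∀ k ∈ Finset.univ, 1 / √(1 - τ * lam k * ∑ j, coordCov b (μ j) k k) *
      Real.exp (τ * lam k / (2 * (1 - τ * lam k * ∑ j, coordCov b (μ j) k k)) *
        (∑ j, coordMean b (μ j) k + (m k - coords b h k / lam k)) ^ 2) ≠ 0 := fun k _ =>
    (mul_pos (hs k) (Real.exp_pos _)).ne'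
  rw [Real.log_mul (Real.exp_pos _).ne' (Finset.prod_ne_zero_iff.2 hne), Real.log_exp,
    Real.log_prod hne, ← Finset.sum_add_distrib]
  refine Finset.sum_congr rfl fun k _ => ?_
  rw [Real.log_mul (hs k).ne' (Real.exp_pos _).ne', Real.log_exp]
  ring

end GibbsIntegral

/-! ### First-order conditions for covariances and means. -/

section FirstOrder

lemma eq_zero_of_quadratic_nonneg {A B : ℝ} (hB : 0 ≤ B)
    (h : ∀ t : ℝ, 0 ≤ A * t + B * t ^ 2) : A = 0 := by
  by_contra hA
  -- The denominator `B + 1` rather than `2 * B` also covers `B = 0`.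
  have h1 := h (-A / (B + 1))
  have h2 : A * (-A / (B + 1)) + B * (-A / (B + 1)) ^ 2 = -(A ^ 2 / (B + 1) ^ 2) := by
    field_simp
    ring
  have h3 : 0 < A ^ 2 / (B + 1) ^ 2 := by positivity
  linarith

/-- Both sides vanish at `t = 0`, so their difference has a maximum there and their slopes `ε` and
`A` agree. -/
lemma eq_of_log_le_quadratic {ε A : ℝ}
    (h : ∀ t : ℝ, -1 < t → ε * Real.log (1 + t) ≤ A / 2 * (2 * t + t ^ 2)) : ε = A := by
  have hd : HasDerivAt (fun t : ℝ => ε * Real.log (1 + t) - A / 2 * (2 * t + t ^ 2))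
      (ε * (1 / (1 + 0)) - A / 2 * (2 * 1 + 2 * 0)) 0 := by
    have h1 : HasDerivAt (fun t : ℝ => 1 + t) 1 0 := (hasDerivAt_id 0).const_add 1
    have h2 := (h1.log (by norm_num)).const_mul ε
    have h3 : HasDerivAt (fun t : ℝ => 2 * t + t ^ 2) (2 * 1 + 2 * 0) 0 := by
      refine (((hasDerivAt_id (0 : ℝ)).const_mul 2).add (hasDerivAt_pow 2 (0 : ℝ))).congr_deriv ?_
      norm_num
    exact h2.sub (h3.const_mul (A / 2))
  have hmax : IsLocalMax (fun t : ℝ => ε * Real.log (1 + t) - A / 2 * (2 * t + t ^ 2)) 0 := by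
    filter_upwards [lt_mem_nhds (show (-1 : ℝ) < 0 by norm_num)] with t ht
    have := h t ht
    simp
    linarith
  have := hmax.hasDerivAt_eq_zero hd
  linarith

variable {N n : ℕ} {b : OrthonormalBasis (Fin n) ℝ (Action n)} {lam : Fin n → ℝ}
  {H : Matrix (Fin n) (Fin n) ℝ}

/-- Own variance shifts the payoff by an amount independent of the opponents. The factor leaves the
risk term as a constant, which is why equilibrium covariances do not depend on `τ`. -/
lemma gibbsWeight_add_variance (lam : Fin n → ℝ) (h : Action n) (r τ : ℝ) (m σ : Fin n → ℝ)
    (k : Fin n) (D : ℝ) {ι : Type*} [Fintype ι] (c : ι → Action n) :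
    gibbsWeight b lam h r τ m (fun q => σ q + if q = k then D else 0) c =
      Real.exp (τ * ((lam k + r) / 2 * D)) * gibbsWeight b lam h r τ m σ c := by
  rw [gibbsWeight, gibbsWeight, ← Real.exp_add]
  congr 1
  have h1 : meanPayoff lam (coords b h) r m (fun q => σ q + if q = k then D else 0)
      (coords b (∑ j, c j)) = meanPayoff lam (coords b h) r m σ (coords b (∑ j, c j))
        - (lam k + r) / 2 * D := by
    have h2 : (lam k + r) / 2 * D = ∑ q, if q = k then (lam q + r) / 2 * D else 0 := by simp
    rw [h2, meanPayoff, meanPayoff, ← Finset.sum_sub_distrib]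
    refine Finset.sum_congr rfl fun q _ => ?_
    split_ifs <;> ring
  rw [h1]
  ring

/-- The optimality condition with respect to deviations that preserve the mean. -/
lemma log_le_of_isGaussianRQE (hlam : ∀ k, 0 < lam k)
    (hb : ∀ k, Matrix.toEuclideanLin H (b k) = -lam k • b k)
    {h : Action n} {ρ τ ε : Fin N → ℝ} {x : Profile N n} (hx : IsGaussianRQE H h ρ τ ε x)
    (i : Fin N) (hρ : 0 ≤ ρ i) (hτ : 0 < τ i) (hε : 0 < ε i) (k l : Fin n) (t : ℝ)
    (ht : 0 < 1 + if l = k then t else 0) :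
    ε i * Real.log (1 + if l = k then t else 0) ≤ (lam k + ρ i) / 2 *
      (2 * t * coordCov b (x i) k l + t ^ 2 * coordCov b (x i) l l) := by
  obtain ⟨hint, hdev⟩ := deviation_le hlam hb hx i hρ hτ hε
  set D := 2 * t * coordCov b (x i) k l + t ^ 2 * coordCov b (x i) l l
  -- The translation `s = -(t * coordMean b (x i) l)` undoes the shift of the mean caused by the
  -- linear part.
  have hm : coordMean b (x i) = fun q => coordMean b (x i) q +
      if q = k then t * coordMean b (x i) l + -(t * coordMean b (x i) l) else 0 := by
    funext q
    split_ifs <;> ring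
  have hW : gibbsWeight b lam h (ρ i) (τ i) (coordMean b (x i))
      (fun q => coordCov b (x i) q q + if q = k then D else 0) =
      fun c : OpponentAction n i => Real.exp (τ i * ((lam k + ρ i) / 2 * D)) *
        gibbsWeight b lam h (ρ i) (τ i) (coordMean b (x i)) (fun q => coordCov b (x i) q q) c :=
    funext fun c => gibbsWeight_add_variance lam h _ _ _ _ _ _ c
  have key := hdev k l t (-(t * coordMean b (x i) l)) ht _ _ hm rfl
    (by rw [hW]; exact hint.const_mul _)
  have hpos : 0 < ∫ c, gibbsWeight b lam h (ρ i) (τ i) (coordMean b (x i))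
      (fun q => coordCov b (x i) q q) c ∂(opponents x i) := integral_exp_pos hint
  rw [hW, integral_const_mul, Real.log_mul (Real.exp_pos _).ne' hpos.ne', Real.log_exp,
    mul_add, ← mul_assoc, neg_mul, one_div_mul_cancel hτ.ne'] at key
  linarith

/-- The covariance of an equilibrium strategy in the eigenbasis of `H`. -/
lemma coordCov_eq_of_isGaussianRQE (hlam : ∀ k, 0 < lam k)
    (hb : ∀ k, Matrix.toEuclideanLin H (b k) = -lam k • b k)
    {h : Action n} {ρ τ ε : Fin N → ℝ} {x : Profile N n} (hx : IsGaussianRQE H h ρ τ ε x)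
    (i : Fin N) (hρ : 0 ≤ ρ i) (hτ : 0 < τ i) (hε : 0 < ε i) (k l : Fin n) :
    coordCov b (x i) k l = if k = l then ε i / (lam k + ρ i) else 0 := by
  have hc : 0 < lam k + ρ i := by linarith [hlam k]
  have key := log_le_of_isGaussianRQE hlam hb hx i hρ hτ hε k l
  split_ifs with hkl
  · subst hkl
    simp only [if_true] at key
    rw [eq_div_iff hc.ne']
    symm
    -- Stretching by `1 + t` along `b k` trades entropy against variance cost.
    refine eq_of_log_le_quadratic fun t ht => (key t (by linarith)).trans_eq ?_
    ring
  · have hlk : l ≠ k := fun h => hkl h.symm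
    -- A shear with `l ≠ k` preserves volume and entropy, so the term linear in `t`, which carries
    -- the covariance, must vanish.
    simp only [if_neg hlk, add_zero, Real.log_one, mul_zero, zero_lt_one, forall_const] at key
    have h0 := eq_zero_of_quadratic_nonneg
      (A := (lam k + ρ i) * coordCov b (x i) k l)
      (B := (lam k + ρ i) / 2 * coordCov b (x i) l l)
      (mul_nonneg (by linarith) (coordCov_self_nonneg _ _))
      fun t => (key t).trans_eq (by ring)
    exact (mul_eq_zero.1 h0).resolve_left hc.ne'

/-- The variance of the opponents' aggregate action in the `k`-th eigendirection. -/
noncomputable def oppVar (lam : Fin n → ℝ) (ρ ε : Fin N → ℝ) (i : Fin N) (k : Fin n) : ℝ :=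
  ∑ j : {j : Fin N // j ≠ i}, ε j / (lam k + ρ j)

/-- With two players there is an opponent whose noise creates risk; this makes the dependence on `τ`
strict. -/
lemma oppVar_pos (hN : 2 ≤ N) (hlam : ∀ k, 0 < lam k) {ρ ε : Fin N → ℝ} (hρ : ∀ i, 0 < ρ i)
    (hε : ∀ i, 0 < ε i) (i : Fin N) (k : Fin n) : 0 < oppVar lam ρ ε i k := by
  have : Nontrivial (Fin N) := Fin.nontrivial_iff_two_le.2 hN
  obtain ⟨j, hj⟩ := exists_ne i
  have : Nonempty {j : Fin N // j ≠ i} := ⟨⟨j, hj⟩⟩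
  exact Finset.sum_pos (fun j _ => div_pos (hε j) (by linarith [hlam k, hρ j]))
    Finset.univ_nonempty

/-- The equilibrium conditions for the means, in the eigenbasis of `H`. -/
lemma coordMean_eq_of_isGaussianRQE (hN : 2 ≤ N) (hlam : ∀ k, 0 < lam k)
    (hb : ∀ k, Matrix.toEuclideanLin H (b k) = -lam k • b k)
    {h : Action n} {ρ τ ε : Fin N → ℝ} (hρ : ∀ i, 0 < ρ i) (hε : ∀ i, 0 < ε i)
    (hτ : ∀ i, 0 < τ i) {x : Profile N n} (hx : IsGaussianRQE H h ρ τ ε x)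
    (i : Fin N) (k : Fin n) :
    τ i * lam k * oppVar lam ρ ε i k < 1 ∧
    ρ i * coordMean b (x i) k = -(lam k / (1 - τ i * lam k * oppVar lam ρ ε i k)) *
      (∑ j, coordMean b (x j) k - coords b h k / lam k) := by
  have hG := hx.1
  have hcov := fun j => coordCov_eq_of_isGaussianRQE hlam hb hx j (hρ j).le (hτ j) (hε j)
  have hoff : ∀ (j : {j : Fin N // j ≠ i}) k l, k ≠ l → coordCov b (x j) k l = 0 :=
    fun j k l hkl => by rw [hcov, if_neg hkl]
  have hVar : ∀ k, ∑ j : {j : Fin N // j ≠ i}, coordCov b (x j) k k = oppVar lam ρ ε i k :=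
    fun k => Finset.sum_congr rfl fun j _ => by rw [hcov, if_pos rfl]
  have hV : ∀ k, 0 < ∑ j : {j : Fin N // j ≠ i}, coordCov b (x j) k k := fun k => by
    rw [hVar]; exact oppVar_pos hN hlam hρ hε i k
  obtain ⟨hint, hdev⟩ := deviation_le hlam hb hx i (hρ i).le (hτ i) (hε i)
  have hlt := (integrable_gibbsWeight_iff hlam hoff hV h (ρ i) (τ i) _ _).1 hint
  have hlt' := fun k => hVar k ▸ hlt k
  refine ⟨hlt' k, ?_⟩
  have h1V : 0 < 1 - τ i * lam k * oppVar lam ρ ε i k := by linarith [hlt' k]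
  set σ : Fin n → ℝ := fun k => coordCov b (x i) k k
  set m := coordMean b (x i : Measure (Action n)) with hm
  set M : Fin n → ℝ := fun k => ∑ j : {j : Fin N // j ≠ i}, coordMean b (x j) k with hM
  -- The part of the log-integral that depends on the own mean `u` in direction `q`; the equilibrium
  -- mean minimizes it.
  set g : Fin n → ℝ → ℝ := fun q u => τ i * ρ i / 2 * u ^ 2 +
    τ i * lam q / (2 * (1 - τ i * lam q * oppVar lam ρ ε i q)) *
      (M q + (u - coords b h q / lam q)) ^ 2 with hg
  have hlog : ∀ m' : Fin n → ℝ,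
      Real.log (∫ c, gibbsWeight b lam h (ρ i) (τ i) m' σ c ∂(opponents x i)) =
      ∑ q, (gibbsConst lam (coords b h) (ρ i) (τ i) 0 σ q
        + Real.log (1 / √(1 - τ i * lam q * oppVar lam ρ ε i q)) + g q (m' q)) := fun m' => by
    rw [opponents, log_integral_gibbsWeight hlam hoff hV h _ _ _ _ hlt]
    refine Finset.sum_congr rfl fun q _ => ?_
    simp only [hVar, hg, hM, gibbsConst, Pi.zero_apply]
    ring
  have hineq : ∀ s : ℝ, g k (m k) ≤ g k (m k + s) := by
    intro s
    set m' : Fin n → ℝ := fun q => m q + if q = k then s else 0 with hm'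
    -- With `t = 0` the deviation is a translation by `s` along `b k`.
    have h1 := hdev k k 0 s (by simp) m' σ (by simp [hm']) (by simp [σ])
      ((integrable_gibbsWeight_iff hlam hoff hV h (ρ i) (τ i) _ _).2 hlt)
    simp only [if_true, add_zero, Real.log_one, mul_zero] at h1
    have h2 := mul_le_mul_of_nonneg_left h1 (hτ i).le
    have h3 : ∀ u : ℝ, τ i * (-(1 / τ i) * u) = -u := fun u => by
      have := (hτ i).ne'
      field_simp
    rw [h3, h3, neg_le_neg_iff, hlog, hlog, ← sub_nonneg, ← Finset.sum_sub_distrib,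
      Finset.sum_eq_single k] at h2
    · simp only [hm', if_true] at h2
      linarith
    · intro q _ hq
      simp [hm', hq]
    · simp
  have hP : 0 < lam k / (1 - τ i * lam k * oppVar lam ρ ε i k) := div_pos (hlam k) h1V
  -- `g k (m k + s) - g k (m k) = A * s + B * s ^ 2`, so `A` is the derivative of `g k` at the
  -- equilibrium mean.
  have h0 := eq_zero_of_quadratic_nonneg
    (A := τ i * (ρ i * m k + lam k / (1 - τ i * lam k * oppVar lam ρ ε i k) *
      (M k + (m k - coords b h k / lam k))))
    (B := τ i / 2 * (ρ i + lam k / (1 - τ i * lam k * oppVar lam ρ ε i k)))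
    (mul_nonneg (by linarith [hτ i]) (by linarith [hρ i])) fun s => by
      have h1 := sub_nonneg.2 (hineq s)
      refine h1.trans_eq ?_
      simp only [hg]
      have h2 := h1V.ne'
      have h3 : τ i * lam k / (2 * (1 - τ i * lam k * oppVar lam ρ ε i k)) =
          τ i / 2 * (lam k / (1 - τ i * lam k * oppVar lam ρ ε i k)) := by
        field_simp
      rw [h3]
      ring
  have h4 := (mul_eq_zero.1 h0).resolve_left (hτ i).ne'
  rw [Fintype.sum_eq_add_sum_subtype_ne _ i]
  have h5 : (∑ j : {j : Fin N // j ≠ i}, coordMean b (x j) k) = M k := rfl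
  rw [h5]
  linarith

end FirstOrder

/-! ### The expected reward in closed form and its monotonicity. -/

section Reward

variable {N n : ℕ} {b : OrthonormalBasis (Fin n) ℝ (Action n)} {lam : Fin n → ℝ}
  {H : Matrix (Fin n) (Fin n) ℝ}

lemma integrable_sharedReward (hb : ∀ k, Matrix.toEuclideanLin H (b k) = -lam k • b k)
    (h : Action n) (x : Profile N n) (hx : ∀ i, IsGaussian (x i : Measure (Action n))) :
    Integrable (sharedReward H h) (jointLaw x) := by
  have hf : sharedReward (N := N) H h = fun a => ∑ k,
      (-lam k / 2 * (inner ℝ (b k) (∑ i, a i)) ^ 2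
        + inner ℝ (b k) h * inner ℝ (b k) (∑ i, a i) + 0) := by
    funext a
    simp only [sharedReward_eq hb, add_zero]
  rw [hf, jointLaw]
  exact integrable_finsetSum _ fun k _ => integrable_quadratic (memLp_coords_sum k) _ _ _

lemma expectedReward_eq (hb : ∀ k, Matrix.toEuclideanLin H (b k) = -lam k • b k)
    (h : Action n) (x : Profile N n) (hx : ∀ i, IsGaussian (x i : Measure (Action n))) :
    expectedReward H h x = ∑ k, (-lam k / 2 * (∑ j, coordCov b (x j) k k
      + (∑ j, coordMean b (x j) k) ^ 2) + coords b h k * ∑ j, coordMean b (x j) k) := by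
  have hf : sharedReward (N := N) H h = fun a => ∑ k,
      (-lam k / 2 * (inner ℝ (b k) (∑ i, a i)) ^ 2
        + inner ℝ (b k) h * inner ℝ (b k) (∑ i, a i) + 0) := by
    funext a
    simp only [sharedReward_eq hb, add_zero]
  rw [expectedReward, hf, jointLaw,
    integral_finsetSum _ fun k _ => integrable_quadratic (memLp_coords_sum k) _ _ _]
  refine Finset.sum_congr rfl fun k _ => ?_
  rw [integral_quadratic (memLp_coords_sum k), integral_coords_sum,
    ← covariance_self (memLp_coords_sum k).aemeasurable, covariance_coords_sum, add_zero]
  rfl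

/-- The aggregate response coefficient: at an equilibrium, the mean aggregate action `M` satisfies
`M = -aggResponse • (M - η / lam)` in the `k`-th eigendirection. -/
noncomputable def aggResponse (lam : Fin n → ℝ) (ρ τ ε : Fin N → ℝ) (k : Fin n) : ℝ :=
  ∑ i, lam k / (1 - τ i * lam k * oppVar lam ρ ε i k) / ρ i

lemma aggResponse_nonneg (hlam : ∀ k, 0 < lam k) {ρ τ ε : Fin N → ℝ} (hρ : ∀ i, 0 < ρ i)
    (k : Fin n) (hlt : ∀ i, τ i * lam k * oppVar lam ρ ε i k < 1) :
    0 ≤ aggResponse lam ρ τ ε k :=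
  Finset.sum_nonneg fun i _ => div_nonneg (div_nonneg (hlam k).le (by linarith [hlt i]))
    (hρ i).le

lemma aggResponse_lt (hN : 2 ≤ N) (hlam : ∀ k, 0 < lam k) {ρ τ τ' ε : Fin N → ℝ}
    (hρ : ∀ i, 0 < ρ i) (hε : ∀ i, 0 < ε i) (k : Fin n)
    (hlt' : ∀ i, τ' i * lam k * oppVar lam ρ ε i k < 1) (hττ' : τ < τ') :
    aggResponse lam ρ τ ε k < aggResponse lam ρ τ' ε k := by
  obtain ⟨hle, i, hi⟩ := Pi.lt_def.1 hττ'
  have hv := fun i => oppVar_pos (lam := lam) hN hlam hρ hε i k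
  refine Finset.sum_lt_sum (fun j _ => ?_) ⟨i, Finset.mem_univ i, ?_⟩
  · have h1 : τ j * lam k * oppVar lam ρ ε j k ≤ τ' j * lam k * oppVar lam ρ ε j k :=
      mul_le_mul_of_nonneg_right (mul_le_mul_of_nonneg_right (hle j) (hlam k).le) (hv j).le
    have h2 := hlt' j
    refine div_le_div_of_nonneg_right (div_le_div_of_nonneg_left (hlam k).le ?_ ?_) (hρ j).le
      <;> linarith
  · have h1 : τ i * lam k * oppVar lam ρ ε i k < τ' i * lam k * oppVar lam ρ ε i k :=
      mul_lt_mul_of_pos_right (mul_lt_mul_of_pos_right hi (hlam k)) (hv i)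
    have h2 := hlt' i
    refine div_lt_div_of_pos_right (div_lt_div_of_pos_left (hlam k) ?_ ?_) (hρ i) <;> linarith

/-- The expected reward at a Gaussian equilibrium, in closed form. -/
lemma expectedReward_of_isGaussianRQE (hN : 2 ≤ N) (hlam : ∀ k, 0 < lam k)
    (hb : ∀ k, Matrix.toEuclideanLin H (b k) = -lam k • b k)
    {h : Action n} {ρ τ ε : Fin N → ℝ} (hρ : ∀ i, 0 < ρ i) (hε : ∀ i, 0 < ε i)
    (hτ : ∀ i, 0 < τ i) {x : Profile N n} (hx : IsGaussianRQE H h ρ τ ε x) :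
    (∀ i k, τ i * lam k * oppVar lam ρ ε i k < 1) ∧
    expectedReward H h x = ∑ k, (coords b h k ^ 2 / (2 * lam k)
      - lam k / 2 * ∑ j, ε j / (lam k + ρ j)
      - coords b h k ^ 2 / (2 * lam k) / (1 + aggResponse lam ρ τ ε k) ^ 2) := by
  have hmean := fun i k => coordMean_eq_of_isGaussianRQE hN hlam hb hρ hε hτ hx i k
  have hlt : ∀ i k, τ i * lam k * oppVar lam ρ ε i k < 1 := fun i k => (hmean i k).1
  refine ⟨hlt, ?_⟩
  rw [expectedReward_eq hb h x hx.1]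
  refine Finset.sum_congr rfl fun k _ => ?_
  have hcov : ∑ j, coordCov b (x j) k k = ∑ j, ε j / (lam k + ρ j) :=
    Finset.sum_congr rfl fun j _ => by
      rw [coordCov_eq_of_isGaussianRQE hlam hb hx j (hρ j).le (hτ j) (hε j), if_pos rfl]
  rw [hcov]
  set V := ∑ j, ε j / (lam k + ρ j)
  set M := ∑ j, coordMean b (x j) k with hM
  set Q := aggResponse lam ρ τ ε k with hQ
  have hQ0 : 0 ≤ Q := aggResponse_nonneg hlam hρ k fun i => hlt i k
  -- The players' mean conditions, divided by `ρ i` and summed.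
  have hMQ : M = -Q * (M - coords b h k / lam k) := by
    conv_lhs => rw [hM]
    rw [hQ, aggResponse, ← Finset.sum_neg_distrib, Finset.sum_mul]
    refine Finset.sum_congr rfl fun i _ => ?_
    have h1 := (hmean i k).2
    have h2 := (hρ i).ne'
    rw [← hM] at h1
    rw [neg_div', div_mul_eq_mul_div, eq_div_iff h2, mul_comm, h1]
  have hl := (hlam k).ne'
  have hQ1 : (1 + Q) ≠ 0 := by linarith
  have hd : M = coords b h k / lam k - coords b h k / lam k / (1 + Q) := by
    field_simp
    field_simp at hMQ
    linarith
  rw [hd]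
  field_simp
  ring

lemma exists_coords_ne_zero {h : Action n} (hh : h ≠ 0) : ∃ k, coords b h k ≠ 0 := by
  by_contra! hk
  rw [← b.sum_repr' h] at hh
  refine hh (Finset.sum_eq_zero fun k _ => ?_)
  have hk' : (inner ℝ (b k) h : ℝ) = 0 := hk k
  rw [hk', zero_smul]

/-- Among Gaussian equilibria, the expected shared reward strictly increases with the degrees of
risk aversion. -/
lemma expectedReward_lt (hN : 2 ≤ N) (hlam : ∀ k, 0 < lam k)
    (hb : ∀ k, Matrix.toEuclideanLin H (b k) = -lam k • b k)
    {h : Action n} (hh : h ≠ 0) {ρ τ τ' ε : Fin N → ℝ} (hρ : ∀ i, 0 < ρ i)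
    (hε : ∀ i, 0 < ε i) (hτ : ∀ i, 0 < τ i) (hτ' : ∀ i, 0 < τ' i) {x x' : Profile N n}
    (hx : IsGaussianRQE H h ρ τ ε x) (hx' : IsGaussianRQE H h ρ τ' ε x') (hlt : τ < τ') :
    expectedReward H h x < expectedReward H h x' := by
  obtain ⟨h1, h2⟩ := expectedReward_of_isGaussianRQE hN hlam hb hρ hε hτ hx
  obtain ⟨h1', h2'⟩ := expectedReward_of_isGaussianRQE hN hlam hb hρ hε hτ' hx'
  rw [h2, h2']
  have hQ0 := fun k => aggResponse_nonneg hlam hρ k fun i => h1 i k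
  have hQ := fun k => aggResponse_lt hN hlam hρ hε k (fun i => h1' i k) hlt
  have hsq : ∀ k, (1 + aggResponse lam ρ τ ε k) ^ 2 < (1 + aggResponse lam ρ τ' ε k) ^ 2 :=
    fun k => pow_lt_pow_left₀ (by linarith [hQ k]) (by linarith [hQ0 k]) two_ne_zero
  have hpos : ∀ k, 0 < (1 + aggResponse lam ρ τ ε k) ^ 2 := fun k =>
    pow_pos (by linarith [hQ0 k]) 2
  obtain ⟨k₀, hk₀⟩ := exists_coords_ne_zero (b := b) hh
  -- Each eigendirection contributes weakly, and one in which `h` has a nonzero coordinate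
  -- contributes strictly.
  refine Finset.sum_lt_sum (fun k _ => ?_) ⟨k₀, Finset.mem_univ _, ?_⟩
  · refine sub_le_sub_left (div_le_div_of_nonneg_left ?_ (hpos k) (hsq k).le) _
    have := hlam k
    positivity
  · refine sub_lt_sub_left (div_lt_div_of_pos_left ?_ (hpos k₀) (hsq k₀)) _
    have := hlam k₀
    positivity

end Reward

end AggregativeGame

theorem mainTheorem1 (N n : ℕ) (hN : 2 ≤ N)
    (H : Matrix (Fin n) (Fin n) ℝ) (hH : (-H).PosDef)
    (h : AggregativeGame.Action n) (hh : h ≠ 0)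
    (ρ ε : Fin N → ℝ) (hρ : ∀ i, 0 < ρ i) (hε : ∀ i, 0 < ε i)
    (xstar : (Fin N → ℝ) → AggregativeGame.Profile N n)
    (hx : ∀ τ ∈ AggregativeGame.riskDomain H h ρ ε,
      AggregativeGame.IsGaussianRQE H h ρ τ ε (xstar τ)) :
    (∀ τ ∈ AggregativeGame.riskDomain H h ρ ε,
      Integrable (AggregativeGame.sharedReward H h) (AggregativeGame.jointLaw (xstar τ))) ∧
    StrictMonoOn (fun τ : Fin N → ℝ => AggregativeGame.expectedReward H h (xstar τ))
      (AggregativeGame.riskDomain H h ρ ε) ∧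
    StrictMonoOn (fun t : ℝ => AggregativeGame.expectedReward H h (xstar (fun _ => t)))
      {t : ℝ | (fun _ => t) ∈ AggregativeGame.riskDomain H h ρ ε} := by
  obtain ⟨b, lam, hlam, hb⟩ := AggregativeGame.exists_eigenbasis hH
  have hmono : StrictMonoOn
      (fun τ : Fin N → ℝ => AggregativeGame.expectedReward H h (xstar τ))
      (AggregativeGame.riskDomain H h ρ ε) := fun τ hτ τ' hτ' hlt =>
    AggregativeGame.expectedReward_lt hN hlam hb hh hρ hε hτ.1 hτ'.1 (hx τ hτ) (hx τ' hτ') hlt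
  -- For a common `t`, constant vectors are strictly ordered in the product order because player `0`
  -- exists.
  refine ⟨fun τ hτ => AggregativeGame.integrable_sharedReward hb h _ (hx τ hτ).1, hmono,
    fun t ht t' ht' hlt => hmono ht ht' (Pi.lt_def.2 ⟨fun _ => hlt.le, ⟨0, by omega⟩, hlt⟩)⟩
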